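/- **Setting.** Let $d\in\{2,3\}$, let $\Omega\subset\mathbb R^d$ be a bounded open set (for instance a convex polyhedral domain), $T>0$, $\nu,\chi,h,H>0$, $\omega\in\mathbb R$, $\alpha\in(0,1)$ and $m\ge 0$ an integer. $(\cdot,\cdot)$ and $\|\cdot\|$ are the $L^2(\Omega)$ inner product and norm, $|\cdot|_k$ is the $H^k(\Omega)$ seminorm, $X=H^1_0(\Omega)^d$, $Q=L^2_0(\Omega)$, $V=\{v\in X:(q,\nabla\cdot v)=0\ \forall q\in Q\}$, $$b^*(u,v,w)=\tfrac12(u\cdot\nabla v,w)-\tfrac12(u\cdot\nabla w,v),\qquad M=\sup_{u,v,w\in X}\frac{b^*(u,v,w)}{\|\nabla u\|\,\|\nabla v\|\,\|\nabla w\|},$$ and $C_2$ is any constant with $b^*(u,v,w)\le C_2\|u\|^{1/2}\|\nabla u\|^{1/2}\|\nabla v\|\|\nabla w\|$ for all $u,v,w\in X$ (such constants exist). Let $X^h\subset X$ and $Q^h\subset Q$ be finite-dimensional, $V^h=\{v\in X^h:(\nabla\cdot v,q)=0\ \forall q\in Q^h\}$, and suppose that, with a constant $C>0$, $$\inf_{v\in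 V^h}\{\|w-v\|+h\|\nabla(w-v)\|\}\le Ch^{m+1}|w|_{m+1}\quad (w\in V\cap H^{m+1}(\Omega)^d),$$ $$\inf_{q\in Q^h}\|r-q\|\le Ch^m|r|_m\quad (r\in Q\cap H^m(\Omega)).$$ Let $I_H$ be an $L^2(\Omega)^d$-orthogonal projection with $\|w-I_Hw\|\le C_1H\|\nabla w\|$ for $w\in X$ and $\|I_Hw\|\le C_3\|w\|$ for $w\in H^1(\Omega)^d$ ($C_1,C_3>0$). Let $R:L^2(\Omega)^d\to L^2(\Omega)^d$ satisfy $(R(w),w)=0$ and $\|R(w)\|\le\|w\|$ for $w\in X$. Let $(u,p)$, with $u(t)\in V$ and $p(t)\in Q$, be a weak solution on $[0,T]$, with some forcing $f(t)\in X'$, of $$(u_t,w)+b^*(u,u,w)+\nu(\nabla u,\nabla w)-(p,\nabla\cdot w)+(\omega R(u),w)=(f,w)\quad\forall w\in X,\ \text{a.e. }t,$$ and let $v^h(t)\in V^h$, $\lambda^h(t)\in Q^h$ solve the nudged semi-discrete problem with the same $f$, $$(v^h_t,w)+b^*(v^h,v^h,w)+\nu(\nabla v^h,\nabla w)-(\lambda^h,\nabla\cdot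 w)+\chi(I_H(v^h-u),w)=(f,w)\quad\forall w\in X^h,\ \text{a.e. }t;$$ $u$ and $v^h$ are absolutely continuous from $[0,T]$ to $X$. Assume that $u(t)\in H^{m+1}(\Omega)^d$ for all $t\in[0,T]$ and, for a.e. $t$, $u_t(t)\in V\cap H^{m+1}(\Omega)^d$ and $p(t)\in H^m(\Omega)$, that $|u|_{m+1}$ is bounded on $[0,T]$, that $|u|_{m+1}^4$, $|u_t|_{m+1}^2$, $|p|_m^2$ are integrable on $(0,T)$, that $\|\nabla u\|\in L^4(0,T)$, and that $$\chi-C_2^4\,\tfrac{9261}{8}\,\nu^{-3}\|\nabla v^h\|^4_{L^\infty(0,T;L^2)}\ge\alpha\chi,\qquad \nu-C_1^2H^2\chi>0.$$ **Statement.** Put $e=u-v^h$ and, for $\kappa,c>0$ and $0<t\le T$, $$\begin{aligned}B_{\kappa,c}(t)={}&\kappa e^{-\frac\alpha2\chi t}\|e(0)\|^2+C_3c\,\tfrac2\alpha h^{2m+2}\sup_{0\le s\le T}|u(s)|^2_{m+1}+2\omega^2\Big(\tfrac1\chi+\tfrac{7C_1^2}{2\nu}H^2\Big)\|u\|^2_{L^2(0,T;L^2)}\\&+\tfrac7\nu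 M^2\big(\|\nabla v^h\|^2_{L^4(0,T;L^2)}+\|\nabla u\|^2_{L^4(0,T;L^2)}\big)c\,h^{2m}\Big(\int_0^T|u|^4_{m+1}\,ds\Big)^{1/2}+\tfrac7\nu c\,h^{2m}\int_0^T|p|_m^2\,ds\\&+c\,h^{2m+4}\tfrac7\nu\int_0^t|u_t|^2_{m+1}\,ds+c\,h^{2m+2}|u(t)|^2_{m+1}+8\nu c\,h^{2m}\int_0^T|u|^2_{m+1}\,ds.\end{aligned}$$ For every $C>0$ there is a constant $c>0$ that depends only on $C$ such that, in every situation as above, for all $0<t\le T$: 1. for every $\delta\in(0,1]$, $$\|e(t)\|^2+\frac\nu2\int_0^te^{-\frac\alpha2\chi(t-s)}\|\nabla e(s)\|^2\,ds\le B_{1+\delta,\,c/\delta}(t);$$ 2. if moreover, for every $s\in[0,T]$, the $L^2$ projection $\widetilde u(s)$ of $u(s)$ onto $V^h$ satisfies $\|u-\widetilde u\|+h\|\nabla(u-\widetilde u)\|\le Ch^{m+1}|u|_{m+1}$, then $$\|e(t)\|^2+\frac\nu2\int_0^te^{-\frac\alpha2\chi(t-s)}\|\nabla e(s)\|^2\,ds\le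 B_{1,\,c}(t).$$ -/

import Mathlib

open MeasureTheory Set


noncomputable section

namespace NudgedNSE

/-! ### Lebesgue and Sobolev spaces on an open set `Ω ⊆ ℝ^d` -/

/-- Points of `ℝ^d` and values of vector fields, with the Euclidean norm. -/
abbrev Vec (d : ℕ) := EuclideanSpace ℝ (Fin d)

/-- `d × d` matrices with the Frobenius norm. -/
abbrev Mat (d : ℕ) := EuclideanSpace ℝ (Fin d × Fin d)

/-- `L²(Ω; F)`. -/
abbrev L2 {d : ℕ} (Ω : Set (Vec d)) (F : Type) [NormedAddCommGroup F] :=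
  Lp F 2 (volume.restrict Ω)

/-- The Jacobian matrix `(i, j) ↦ ∂_j φ_i` of a smooth vector field. -/
def classicalGrad {d : ℕ} (φ : Vec d → Vec d) (x : Vec d) : Mat d :=
  WithLp.toLp 2 fun ij => fderiv ℝ φ x (EuclideanSpace.single ij.2 1) ij.1

/-- The pairs `(φ, ∇φ)`, as classes in `L²`, with `φ` a smooth vector field that is compactly
supported in `Ω`. -/
def testPairs {d : ℕ} (Ω : Set (Vec d)) : Set (L2 Ω (Vec d) × L2 Ω (Mat d)) :=
  {z | ∃ φ : Vec d → Vec d, ContDiff ℝ (⊤ : ℕ∞) φ ∧ HasCompactSupport φ ∧ tsupport φ ⊆ Ω ∧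
    z.1 =ᵐ[volume.restrict Ω] φ ∧ z.2 =ᵐ[volume.restrict Ω] classicalGrad φ}

/-- `X = H¹₀(Ω)^d`: the closure of the compactly supported smooth vector fields in the `H¹` norm.
An element is stored as the pair `(u, ∇u)` in `L² × L²`. -/
def H01 {d : ℕ} (Ω : Set (Vec d)) : Submodule ℝ (L2 Ω (Vec d) × L2 Ω (Mat d)) :=
  (Submodule.span ℝ (testPairs Ω)).topologicalClosure

instance instCompleteSpaceH01 {d : ℕ} (Ω : Set (Vec d)) : CompleteSpace (H01 Ω) :=
  (Submodule.isClosed_topologicalClosure _).completeSpace_coe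

/-- The vector field `u ∈ L²(Ω)^d` underlying an element of `X`. -/
def fn {d : ℕ} {Ω : Set (Vec d)} (u : H01 Ω) : L2 Ω (Vec d) := u.1.1

/-- The gradient `∇u ∈ L²(Ω)^{d×d}` of an element of `X`. -/
def grad {d : ℕ} {Ω : Set (Vec d)} (u : H01 Ω) : L2 Ω (Mat d) := u.1.2

/-- The trace of a matrix, as a continuous linear map. -/
def traceCLM (d : ℕ) : Mat d →L[ℝ] ℝ := ∑ i : Fin d, EuclideanSpace.proj (i, i)

/-- The divergence `∇·u ∈ L²(Ω)` of an element of `X`. -/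
def dv {d : ℕ} {Ω : Set (Vec d)} (u : H01 Ω) : L2 Ω ℝ := (traceCLM d).compLp (grad u)

/-- `Q = L²₀(Ω)`, the square integrable functions of mean zero (as a set). -/
def meanZero {d : ℕ} (Ω : Set (Vec d)) : Set (L2 Ω ℝ) := {q | ∫ x in Ω, q x = 0}

/-- `V`, the divergence free elements of `X`. -/
def divFree {d : ℕ} (Ω : Set (Vec d)) : Set (H01 Ω) :=
  {v | ∀ q ∈ meanZero Ω, inner ℝ q (dv v) = 0}

/-- The classical partial derivative `∂_i φ` of a scalar function. -/
def partialD {d : ℕ} (i : Fin d) (φ : Vec d → ℝ) (x : Vec d) : ℝ :=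
  fderiv ℝ φ x (EuclideanSpace.single i 1)

/-- The classical derivative `∂^a φ` for a multi-index `a`. -/
def multiD {d : ℕ} (a : Fin d → ℕ) (φ : Vec d → ℝ) : Vec d → ℝ :=
  (List.finRange d).foldr (fun i ψ => (partialD i)^[a i] ψ) φ

/-- `g` is the weak derivative `∂^a f` on `Ω`. -/
def IsWeakDeriv {d : ℕ} {Ω : Set (Vec d)} (a : Fin d → ℕ) (f g : L2 Ω ℝ) : Prop :=
  ∀ φ : Vec d → ℝ, ContDiff ℝ (⊤ : ℕ∞) φ → HasCompactSupport φ → tsupport φ ⊆ Ω →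
    ∫ x in Ω, f x * multiD a φ x = (-1) ^ (∑ i, a i) * ∫ x in Ω, g x * φ x

/-- `f ∈ H^k(Ω)`. -/
def MemH {d : ℕ} {Ω : Set (Vec d)} (k : ℕ) (f : L2 Ω ℝ) : Prop :=
  ∀ a : Fin d → ℕ, ∑ i, a i ≤ k → ∃ g : L2 Ω ℝ, IsWeakDeriv a f g

open Classical in
/-- The weak derivative `∂^a f` (zero if there is none in `L²`). -/
def weakD {d : ℕ} {Ω : Set (Vec d)} (a : Fin d → ℕ) (f : L2 Ω ℝ) : L2 Ω ℝ :=
  if hg : ∃ g : L2 Ω ℝ, IsWeakDeriv a f g then hg.choose else 0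

/-- The Sobolev seminorm `|f|_k = (∑_{|a| = k} ‖∂^a f‖²)^{1/2}`. -/
def semi {d : ℕ} {Ω : Set (Vec d)} (k : ℕ) (f : L2 Ω ℝ) : ℝ :=
  √(∑ a ∈ Finset.piAntidiag (Finset.univ : Finset (Fin d)) k, ‖weakD a f‖ ^ 2)

/-- The `i`-th component of a vector field. -/
def comp {d : ℕ} {Ω : Set (Vec d)} (i : Fin d) (u : L2 Ω (Vec d)) : L2 Ω ℝ :=
  (EuclideanSpace.proj i : Vec d →L[ℝ] ℝ).compLp u

/-- `u ∈ H^k(Ω)^d`. -/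
def MemHVec {d : ℕ} {Ω : Set (Vec d)} (k : ℕ) (u : L2 Ω (Vec d)) : Prop :=
  ∀ i, MemH k (comp i u)

/-- The Sobolev seminorm `|u|_k` of a vector field. -/
def semiVec {d : ℕ} {Ω : Set (Vec d)} (k : ℕ) (u : L2 Ω (Vec d)) : ℝ :=
  √(∑ i, semi k (comp i u) ^ 2)

/-! ### The trilinear form -/

/-- `(u · ∇v, w)`. -/
def conv {d : ℕ} {Ω : Set (Vec d)} (u v w : H01 Ω) : ℝ :=
  ∫ x in Ω, ∑ i, ∑ j, fn u x j * grad v x (i, j) * fn w x i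

/-- `b*(u, v, w) = ½ (u · ∇v, w) - ½ (u · ∇w, v)`. -/
def bstar {d : ℕ} {Ω : Set (Vec d)} (u v w : H01 Ω) : ℝ :=
  1 / 2 * conv u v w - 1 / 2 * conv u w v

/-- `M = sup_{u, v, w ∈ X} b*(u, v, w) / (‖∇u‖ ‖∇v‖ ‖∇w‖)`. -/
def Mconst {d : ℕ} (Ω : Set (Vec d)) : ℝ :=
  sSup {r | ∃ u v w : H01 Ω, r = bstar u v w / (‖grad u‖ * ‖grad v‖ * ‖grad w‖)}

/-- `C₂` is a constant with `b*(u, v, w) ≤ C₂ ‖u‖^{1/2} ‖∇u‖^{1/2} ‖∇v‖ ‖∇w‖` on `X`. -/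
def IsTrilinearConstant {d : ℕ} (Ω : Set (Vec d)) (C₂ : ℝ) : Prop :=
  ∀ u v w : H01 Ω,
    bstar u v w ≤ C₂ * √‖fn u‖ * √‖grad u‖ * ‖grad v‖ * ‖grad w‖

/-! ### Time dependent functions -/

/-- `g` is absolutely continuous on `[0, T]` with derivative `g'` (a Bochner integrable function
that is determined almost everywhere). -/
def HasTimeDeriv {E : Type*} [NormedAddCommGroup E] [NormedSpace ℝ E] (T : ℝ)
    (g g' : ℝ → E) : Prop :=
  IntervalIntegrable g' volume 0 T ∧ ∀ t ∈ Icc 0 T, g t = g 0 + ∫ s in (0 : ℝ)..t, g' s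

/-- The norm of `L^k(0, T; E)`, for a finite exponent `k`. -/
def bochnerNorm {E : Type*} [NormedAddCommGroup E] (k : ℕ) (T : ℝ) (g : ℝ → E) : ℝ :=
  (∫ t in (0 : ℝ)..T, ‖g t‖ ^ k) ^ (1 / k : ℝ)

/-- The norm of `L^∞(0, T; E)` of a function that is continuous on `[0, T]`. -/
def supNorm {E : Type*} [NormedAddCommGroup E] (T : ℝ) (g : ℝ → E) : ℝ :=
  ⨆ t : Icc (0 : ℝ) T, ‖g t‖

/-! ### The Navier-Stokes problem and its nudged semi-discretization -/

/-- `(u, p)` is a weak solution on `[0, T]` of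
`u_t + u · ∇u - ν Δu + ∇p + ω R(u) = f`, `∇ · u = 0`, with no-slip boundary condition. -/
structure IsNSESolution {d : ℕ} (Ω : Set (Vec d)) (T ν ω : ℝ)
    (R : L2 Ω (Vec d) → L2 Ω (Vec d)) (f : ℝ → (H01 Ω →L[ℝ] ℝ))
    (u u_t : ℝ → H01 Ω) (p : ℝ → L2 Ω ℝ) : Prop where
  timeDeriv : HasTimeDeriv T u u_t
  div_u : ∀ t ∈ Icc 0 T, u t ∈ divFree Ω
  mean_p : ∀ᵐ t ∂volume.restrict (Ioc 0 T), p t ∈ meanZero Ω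
  momentum : ∀ᵐ t ∂volume.restrict (Ioc 0 T), ∀ w : H01 Ω,
    inner ℝ (fn (u_t t)) (fn w) + bstar (u t) (u t) w + ν * inner ℝ (grad (u t)) (grad w)
      - inner ℝ (p t) (dv w) + inner ℝ (ω • R (fn (u t))) (fn w) = f t w

/-- The regularity of `(u, p)` that gives a meaning to the Sobolev norms in the error bound. -/
structure HasSobolevRegularity {d : ℕ} {Ω : Set (Vec d)} (m : ℕ) (T : ℝ)
    (u u_t : ℝ → H01 Ω) (p : ℝ → L2 Ω ℝ) : Prop where
  mem_u : ∀ t ∈ Icc 0 T, MemHVec (m + 1) (fn (u t))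
  mem_u_t : ∀ᵐ t ∂volume.restrict (Ioc 0 T), u_t t ∈ divFree Ω ∧ MemHVec (m + 1) (fn (u_t t))
  mem_p : ∀ᵐ t ∂volume.restrict (Ioc 0 T), MemH m (p t)
  bdd_u : BddAbove ((fun t => semiVec (m + 1) (fn (u t)) ^ 2) '' Icc 0 T)
  int_u : IntegrableOn (fun t => semiVec (m + 1) (fn (u t)) ^ 4) (Ioc 0 T)
  int_u_t : IntegrableOn (fun t => semiVec (m + 1) (fn (u_t t)) ^ 2) (Ioc 0 T)
  int_p : IntegrableOn (fun t => semi m (p t) ^ 2) (Ioc 0 T)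

/-- The discretely divergence free subspace `V^h` of `X^h`. -/
def discDivFree {d : ℕ} {Ω : Set (Vec d)} (Xh : Submodule ℝ (H01 Ω))
    (Qh : Submodule ℝ (L2 Ω ℝ)) : Set (H01 Ω) :=
  {v | v ∈ Xh ∧ ∀ q ∈ Qh, inner ℝ (dv v) q = 0}

/-- `(v^h, λ^h)` solves the semi-discrete nudged problem on `[0, T]`. -/
structure IsNudgedSolution {d : ℕ} {Ω : Set (Vec d)} (Xh : Submodule ℝ (H01 Ω))
    (Qh : Submodule ℝ (L2 Ω ℝ)) (T ν χ : ℝ) (IH : L2 Ω (Vec d) →L[ℝ] L2 Ω (Vec d))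
    (f : ℝ → (H01 Ω →L[ℝ] ℝ)) (u v v_t : ℝ → H01 Ω) (lam : ℝ → L2 Ω ℝ) : Prop where
  timeDeriv : HasTimeDeriv T v v_t
  mem_v : ∀ t ∈ Icc 0 T, v t ∈ Xh
  mem_lam : ∀ t ∈ Ioc 0 T, lam t ∈ Qh
  div_v : ∀ t ∈ Icc 0 T, ∀ q ∈ Qh, inner ℝ (dv (v t)) q = 0
  momentum : ∀ᵐ t ∂volume.restrict (Ioc 0 T), ∀ w ∈ Xh,
    inner ℝ (fn (v_t t)) (fn w) + bstar (v t) (v t) w + ν * inner ℝ (grad (v t)) (grad w)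
      - inner ℝ (lam t) (dv w) + χ * inner ℝ (IH (fn (v t) - fn (u t))) (fn w) = f t w

/-- The approximation properties of order `m` of `V^h` and `Q^h`, with constant `C`:
`inf_{v ∈ V^h} {‖w - v‖ + h ‖∇(w - v)‖} ≤ C h^{m+1} |w|_{m+1}` for `w ∈ V ∩ H^{m+1}(Ω)^d`, and
`inf_{q ∈ Q^h} ‖r - q‖ ≤ C h^m |r|_m` for `r ∈ Q ∩ H^m(Ω)`. -/
def ApproxProperty {d : ℕ} {Ω : Set (Vec d)} (Xh : Submodule ℝ (H01 Ω))
    (Qh : Submodule ℝ (L2 Ω ℝ)) (m : ℕ) (h C : ℝ) : Prop :=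
  (∀ w ∈ divFree Ω, MemHVec (m + 1) (fn w) →
    (⨅ v : discDivFree Xh Qh, (‖fn (w - v.1)‖ + h * ‖grad (w - v.1)‖))
      ≤ C * h ^ (m + 1) * semiVec (m + 1) (fn w)) ∧
  (∀ r ∈ meanZero Ω, MemH m r →
    (⨅ q : Qh, ‖r - q.1‖) ≤ C * h ^ m * semi m r)

/-- `I_H` is an `L²` (orthogonal) projection with `‖w - I_H w‖ ≤ C₁ H ‖∇w‖` on `H¹₀(Ω)^d` and
`‖I_H w‖ ≤ C₃ ‖w‖` on `H¹(Ω)^d`. -/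
structure IsObservation {d : ℕ} {Ω : Set (Vec d)} (IH : L2 Ω (Vec d) →L[ℝ] L2 Ω (Vec d))
    (H C₁ C₃ : ℝ) : Prop where
  proj : IsStarProjection IH
  approx : ∀ w : H01 Ω, ‖fn w - IH (fn w)‖ ≤ C₁ * H * ‖grad w‖
  bound : ∀ w : L2 Ω (Vec d), MemHVec 1 w → ‖IH w‖ ≤ C₃ * ‖w‖

/-- `(R(w), w) = 0` and `‖R(w)‖ ≤ ‖w‖` on `X`, as for a Coriolis force. -/
def IsCoriolisLike {d : ℕ} {Ω : Set (Vec d)} (R : L2 Ω (Vec d) → L2 Ω (Vec d)) : Prop :=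
  ∀ w : H01 Ω, inner ℝ (R (fn w)) (fn w) = 0 ∧ ‖R (fn w)‖ ≤ ‖fn w‖

/-- The `L²` projection `z` of `u(s)` onto `V^h` satisfies
`‖u(s) - z‖ + h ‖∇(u(s) - z)‖ ≤ C h^{m+1} |u(s)|_{m+1}`, for every `s ∈ [0, T]`. -/
def ProjectionApproximates {d : ℕ} {Ω : Set (Vec d)} (Xh : Submodule ℝ (H01 Ω))
    (Qh : Submodule ℝ (L2 Ω ℝ)) (m : ℕ) (h C T : ℝ) (u : ℝ → H01 Ω) : Prop :=
  ∀ s ∈ Icc 0 T, ∀ z ∈ discDivFree Xh Qh,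
    (∀ y ∈ discDivFree Xh Qh, inner ℝ (fn (u s - z)) (fn y) = 0) →
    ‖fn (u s - z)‖ + h * ‖grad (u s - z)‖ ≤ C * h ^ (m + 1) * semiVec (m + 1) (fn (u s))

/-- `‖e(t)‖² + (ν/2) ∫₀ᵗ exp(-(α/2) χ (t - s)) ‖∇e(s)‖² ds` for the error `e = u - v`. -/
def errorEnergy {d : ℕ} {Ω : Set (Vec d)} (ν χ α : ℝ) (u v : ℝ → H01 Ω) (t : ℝ) : ℝ :=
  ‖fn (u t - v t)‖ ^ 2
    + ν / 2 * ∫ s in (0 : ℝ)..t, Real.exp (-(α / 2) * χ * (t - s)) * ‖grad (u s - v s)‖ ^ 2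

/-- The right-hand side of the error estimate at time `t`, with the factor `κ` in front of the
initial error and the generic constant `c` in the discretization terms. -/
def errorBound {d : ℕ} {Ω : Set (Vec d)} (m : ℕ) (h H T ν ω χ α C₁ C₃ : ℝ)
    (u u_t v : ℝ → H01 Ω) (p : ℝ → L2 Ω ℝ) (κ c t : ℝ) : ℝ :=
  κ * Real.exp (-(α / 2) * χ * t) * ‖fn (u 0 - v 0)‖ ^ 2
  + C₃ * c * (2 / α) * h ^ (2 * m + 2) * (⨆ s : Icc (0 : ℝ) T, semiVec (m + 1) (fn (u s)) ^ 2)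
  + 2 * ω ^ 2 * (1 / χ + 7 * C₁ ^ 2 / (2 * ν) * H ^ 2) * bochnerNorm 2 T (fun s => fn (u s)) ^ 2
  + 7 / ν * Mconst Ω ^ 2
    * (bochnerNorm 4 T (fun s => grad (v s)) ^ 2 + bochnerNorm 4 T (fun s => grad (u s)) ^ 2)
    * (c * h ^ (2 * m) * √(∫ s in (0 : ℝ)..T, semiVec (m + 1) (fn (u s)) ^ 4))
  + 7 / ν * c * h ^ (2 * m) * (∫ s in (0 : ℝ)..T, semi m (p s) ^ 2)
  + c * h ^ (2 * m + 4) * (7 / ν) * (∫ s in (0 : ℝ)..t, semiVec (m + 1) (fn (u_t s)) ^ 2)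
  + c * h ^ (2 * m + 2) * semiVec (m + 1) (fn (u t)) ^ 2
  + 8 * ν * c * h ^ (2 * m) * (∫ s in (0 : ℝ)..T, semiVec (m + 1) (fn (u s)) ^ 2)

end NudgedNSE

end

open NudgedNSE

/-!
Write `e = u - v = η + φ` with `η = u - P u` and `φ = P u - v`, where `P` is a linear projection of
`X` onto `V^h` that does not depend on time. The error equation, tested with `φ ∈ V^h`, gives an
energy inequality for `φ` at almost every time (`energy_inequality_at_time`). The nudging term
provides the damping: `χ ‖I_H φ‖² ≥ χ ‖φ‖² - χ C₁² H² ‖∇φ‖² ≥ χ ‖φ‖² - ν ‖∇φ‖²`. The part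
`b*(φ, v, φ)` of the nonlinear term is absorbed by the condition on `χ`, the term `ω R(u)` is split
along `I_H`, and all other terms are small because `η` is. Gronwall's inequality
(`HasTimeDeriv.gronwall`) with rate `α χ / 2` then bounds `φ`.

Two projections are used. The first is orthogonal for the scaled inner product
`(v, w) + h² (∇v, ∇w)` (`ErrorSetting.exists_scaled_projection`). It minimizes the scaled `H¹` norm,
so it inherits the approximation property of `V^h`, and `(η_t, φ) = -h² (∇η_t, ∇φ)` explains the
order `h^{2m+4}` of the term with `u_t`. Since `η` is not orthogonal to `V^h` in `L²`, the splitting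
of `e(0)` costs the factor `1 + δ`; the contribution of `η(0)` is moved to time `t` by the
fundamental theorem of calculus (`ErrorSetting.initial_projection_error_le`). The second is the `L²`
projection, for which `‖e‖² = ‖η‖² + ‖φ‖²` and `(η_t, φ) = 0`, so that the factor is `1`.

The trilinear form is an honest integral, and `M` a finite supremum, because `H¹₀(Ω)` embeds in
`L⁴(Ω)` for `d = 2, 3` (`exists_eLpNorm_four_le`). The factor `C₃` in the estimate comes from
`‖I_H w‖² ≤ C₃ ‖w‖²` (`IsObservation.norm_sq_le`), for which `H¹₀` has to be contained in `H¹`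
in the sense of weak derivatives (`memHVec_one_fn`).
-/

namespace NudgedNSE

/-! ### Test functions and the Sobolev inequality -/

section Sobolev

variable {d : ℕ} {Ω : Set (Vec d)}

lemma classicalGrad_add {φ ψ : Vec d → Vec d} (hφ : ContDiff ℝ (⊤ : ℕ∞) φ)
    (hψ : ContDiff ℝ (⊤ : ℕ∞) ψ) :
    classicalGrad (φ + ψ) = classicalGrad φ + classicalGrad ψ := by
  ext x ij
  simp [classicalGrad, fderiv_add (hφ.differentiable (by simp) x) (hψ.differentiable (by simp) x)]

lemma classicalGrad_const_smul {φ : Vec d → Vec d} (hφ : ContDiff ℝ (⊤ : ℕ∞) φ) (c : ℝ) :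
    classicalGrad (c • φ) = c • classicalGrad φ := by
  ext x ij
  simp [classicalGrad, fderiv_const_smul (hφ.differentiable (by simp) x)]

/-- The test pairs form a subspace, so that taking their span in the definition of `X` adds
nothing. -/
def testSubmodule (Ω : Set (Vec d)) : Submodule ℝ (L2 Ω (Vec d) × L2 Ω (Mat d)) where
  carrier := testPairs Ω
  zero_mem' := ⟨0, contDiff_const, HasCompactSupport.zero, by simp,
    Lp.coeFn_zero _ _ _, by
      filter_upwards [Lp.coeFn_zero (Mat d) 2 (volume.restrict Ω)] with x hx
      refine hx.trans ?_
      ext ij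
      simp [classicalGrad]⟩
  add_mem' := by
    rintro z z' ⟨φ, h1, h2, h3, h4, h5⟩ ⟨ψ, k1, k2, k3, k4, k5⟩
    refine ⟨φ + ψ, h1.add k1, h2.add k2,
      (tsupport_add φ ψ).trans (union_subset h3 k3), ?_, ?_⟩
    · exact (Lp.coeFn_add _ _).trans (h4.add k4)
    · rw [classicalGrad_add h1 k1]
      exact (Lp.coeFn_add _ _).trans (h5.add k5)
  smul_mem' := by
    rintro c z ⟨φ, h1, h2, h3, h4, h5⟩
    refine ⟨c • φ, contDiff_const.smul h1, h2.smul_left (f := fun _ => c),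
      (tsupport_smul_subset_right (fun _ => c) φ).trans h3, ?_, ?_⟩
    · exact (Lp.coeFn_smul _ _).trans (h4.const_smul c)
    · rw [classicalGrad_const_smul h1]
      exact (Lp.coeFn_smul _ _).trans (h5.const_smul c)

lemma H01_eq_closure : (H01 Ω : Set (L2 Ω (Vec d) × L2 Ω (Mat d))) = closure (testPairs Ω) := by
  have : Submodule.span ℝ (testPairs Ω) = testSubmodule Ω :=
    Submodule.span_eq (testSubmodule Ω)
  rw [H01, this]
  rfl

/-- A closed property of pairs `(u, ∇u)` holds on `X` if it holds for test functions. -/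
lemma H01_induction {P : L2 Ω (Vec d) × L2 Ω (Mat d) → Prop} (hP : IsClosed {z | P z})
    (h : ∀ z ∈ testPairs Ω, P z) (w : H01 Ω) : P w.1 := by
  have hw : w.1 ∈ closure (testPairs Ω) := by
    rw [← H01_eq_closure]; exact w.2
  exact closure_minimal (s := testPairs Ω) (t := {z | P z}) h hP hw

lemma norm_fderiv_le_norm_classicalGrad (φ : Vec d → Vec d) (x : Vec d) :
    ‖fderiv ℝ φ x‖ ≤ ‖classicalGrad φ x‖ := by
  refine ContinuousLinearMap.opNorm_le_bound _ (norm_nonneg _) fun y => ?_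
  have hy : y = ∑ j, y j • EuclideanSpace.single j (1 : ℝ) := by
    ext i; simp [Finset.sum_apply, Pi.single_apply]
  have hc : ∀ i, fderiv ℝ φ x y i = ∑ j, classicalGrad φ x (i, j) * y j := by
    intro i
    conv_lhs => rw [hy]
    simp [classicalGrad, mul_comm]
  rw [EuclideanSpace.norm_eq, EuclideanSpace.norm_eq, EuclideanSpace.norm_eq,
    ← Real.sqrt_mul (by positivity)]
  refine Real.sqrt_le_sqrt ?_
  simp only [Real.norm_eq_abs, sq_abs]
  rw [Fintype.sum_prod_type, Finset.sum_mul]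
  refine Finset.sum_le_sum fun i _ => ?_
  rw [hc]
  exact Finset.sum_mul_sq_le_sq_mul_sq _ _ _

/-- The embedding `H¹₀ ⊆ L⁴` for smooth compactly supported fields. The gradient is first estimated
in `L^{12/7}`, an exponent below both dimensions for which `7/12 - 1/d ≤ 1/4`. -/
lemma exists_eLpNorm_four_le_of_smooth (hd : d = 2 ∨ d = 3) (hΩ : Bornology.IsBounded Ω) :
    ∃ K : NNReal, ∀ φ : Vec d → Vec d, ContDiff ℝ (⊤ : ℕ∞) φ → HasCompactSupport φ →
      tsupport φ ⊆ Ω → eLpNorm φ 4 (volume.restrict Ω)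
        ≤ K * eLpNorm (classicalGrad φ) 2 (volume.restrict Ω) := by
  have : IsFiniteMeasure (volume.restrict Ω) := ⟨by
    rw [Measure.restrict_apply_univ]; exact hΩ.measure_lt_top⟩
  set A := eLpNormLESNormFDerivOfLeConst (Vec d) (volume : Measure (Vec d)) Ω (12 / 7) 4
  set B : ENNReal :=
    volume.restrict Ω univ ^ (1 / (12 / 7 : ENNReal).toReal - 1 / (2 : ENNReal).toReal)
  have hq : (12 / 7 : ENNReal).toReal = 12 / 7 := by simp
  have hB : B ≠ ⊤ := by
    refine ENNReal.rpow_ne_top_of_nonneg ?_ (measure_ne_top _ _)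
    rw [hq]; norm_num
  refine ⟨A * B.toNNReal, fun φ h1 h2 h3 => ?_⟩
  have hr : ((12 / 7 : NNReal) : ENNReal) = 12 / 7 := by
    rw [ENNReal.coe_div (by norm_num)]; norm_num
  have h0 : Function.support φ ⊆ Ω := (subset_tsupport φ).trans h3
  have hgns : eLpNorm φ 4 volume ≤ A * eLpNorm (fderiv ℝ φ) (12 / 7) volume := by
    have := eLpNorm_le_eLpNorm_fderiv_of_le (volume : Measure (Vec d)) (p := 12 / 7) (q := 4)
      (h1.of_le (by simp)) h0 (by rw [← NNReal.coe_le_coe]; norm_num)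
      (by rcases hd with rfl | rfl <;> rw [← NNReal.coe_lt_coe] <;> norm_num)
      (by rcases hd with rfl | rfl <;> norm_num) hΩ
    rw [hr] at this
    exact_mod_cast this
  have hsupp : Function.support (fderiv ℝ φ) ⊆ Ω :=
    (subset_tsupport _).trans ((tsupport_fderiv_subset ℝ).trans h3)
  have hres : eLpNorm (fderiv ℝ φ) (12 / 7) (volume.restrict Ω)
      = eLpNorm (fderiv ℝ φ) (12 / 7) volume := by
    rw [← eLpNorm_norm, ← eLpNorm_norm (fderiv ℝ φ) (μ := volume)]
    refine eLpNorm_restrict_eq_of_support_subset ?_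
    exact fun x hx => hsupp fun h => hx (by simp [h])
  calc eLpNorm φ 4 (volume.restrict Ω) ≤ eLpNorm φ 4 volume :=
        eLpNorm_mono_measure _ Measure.restrict_le_self
    _ ≤ A * eLpNorm (fderiv ℝ φ) (12 / 7) (volume.restrict Ω) := by rw [hres]; exact hgns
    _ ≤ A * (eLpNorm (fderiv ℝ φ) 2 (volume.restrict Ω) * B) := by
        gcongr
        refine eLpNorm_le_eLpNorm_mul_rpow_measure_univ ?_
          (h1.continuous_fderiv (by simp)).aestronglyMeasurable
        rw [ENNReal.div_le_iff (by norm_num) (by norm_num)]; norm_num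
    _ ≤ A * (eLpNorm (classicalGrad φ) 2 (volume.restrict Ω) * B) := by
        gcongr
        exact eLpNorm_mono fun x => norm_fderiv_le_norm_classicalGrad φ x
    _ = (A * B.toNNReal : NNReal) * eLpNorm (classicalGrad φ) 2 (volume.restrict Ω) := by
        rw [ENNReal.coe_mul, ENNReal.coe_toNNReal hB]; ring

/-- The embedding `H¹₀(Ω) ⊆ L⁴(Ω)` with constant `K`, with the norm of the gradient only. It makes
the integrals in `b*` converge, so that `b*` is trilinear: the default value `0` of a divergent
integral would not respect sums. -/
def HasL4Embedding (Ω : Set (Vec d)) (K : NNReal) : Prop :=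
  ∀ w : H01 Ω, eLpNorm (fn w) 4 (volume.restrict Ω) ≤ K * ‖grad w‖ₑ

lemma exists_eLpNorm_four_le (hd : d = 2 ∨ d = 3) (hΩ : Bornology.IsBounded Ω) :
    ∃ K : NNReal, HasL4Embedding Ω K := by
  obtain ⟨K, hK⟩ := exists_eLpNorm_four_le_of_smooth hd hΩ
  refine ⟨K, fun w => ?_⟩
  refine H01_induction
    (P := fun z => eLpNorm z.1 4 (volume.restrict Ω) ≤ K * ‖z.2‖ₑ) ?_ ?_ w
  · -- The `L⁴` norm is lower semicontinuous for `L²` convergence, by Fatou's lemma along a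
    -- subsequence that converges almost everywhere.
    refine IsSeqClosed.isClosed fun z w hz hzw => ?_
    have h1 : Filter.Tendsto (fun n => (z n).1) Filter.atTop (nhds w.1) :=
      (continuous_fst.tendsto _).comp hzw
    have h2 : Filter.Tendsto (fun n => (K : ENNReal) * ‖(z n).2‖ₑ) Filter.atTop
        (nhds (K * ‖w.2‖ₑ)) :=
      ENNReal.Tendsto.const_mul
        ((continuous_enorm.tendsto _).comp ((continuous_snd.tendsto _).comp hzw)) (by simp)
    obtain ⟨ns, hns, hae⟩ := (tendstoInMeasure_of_tendsto_Lp h1).exists_seq_tendsto_ae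
    calc eLpNorm w.1 4 (volume.restrict Ω)
        ≤ Filter.liminf (fun n => eLpNorm (z (ns n)).1 4 (volume.restrict Ω)) Filter.atTop :=
          Lp.eLpNorm_lim_le_liminf_eLpNorm (fun n => Lp.aestronglyMeasurable _) _ hae
      _ ≤ Filter.liminf (fun n => (K : ENNReal) * ‖(z (ns n)).2‖ₑ) Filter.atTop :=
          Filter.liminf_le_liminf (Filter.Eventually.of_forall fun n => hz (ns n))
      _ = K * ‖w.2‖ₑ := (h2.comp hns.tendsto_atTop).liminf_eq
  · rintro z ⟨φ, h1, h2, h3, h4, h5⟩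
    rw [eLpNorm_congr_ae h4, Lp.enorm_def, eLpNorm_congr_ae h5]
    exact hK φ h1 h2 h3

end Sobolev

/-! ### The trilinear form -/

section Trilinear

variable {d : ℕ} {Ω : Set (Vec d)}

lemma fn_add (u v : H01 Ω) : fn (u + v) = fn u + fn v := rfl
lemma grad_add (u v : H01 Ω) : grad (u + v) = grad u + grad v := rfl

/-- `u ↦ fn u` as a continuous linear map. -/
noncomputable def fnCLM (Ω : Set (Vec d)) : H01 Ω →L[ℝ] L2 Ω (Vec d) :=
  (ContinuousLinearMap.fst ℝ _ _).comp (H01 Ω).subtypeL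

/-- `u ↦ ∇u` as a continuous linear map. -/
noncomputable def gradCLM (Ω : Set (Vec d)) : H01 Ω →L[ℝ] L2 Ω (Mat d) :=
  (ContinuousLinearMap.snd ℝ _ _).comp (H01 Ω).subtypeL

lemma fnCLM_apply (u : H01 Ω) : fnCLM Ω u = fn u := rfl

/-- `∑ i j, a_j G_ij b_i`, the integrand of the convective term. -/
def convPoint {d : ℕ} (a : Vec d) (G : Mat d) (b : Vec d) : ℝ :=
  ∑ i, ∑ j, a j * G (i, j) * b i

lemma abs_convPoint_le (a : Vec d) (G : Mat d) (b : Vec d) :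
    |convPoint a G b| ≤ ‖a‖ * ‖G‖ * ‖b‖ := by
  have h1 : convPoint a G b = ∑ ij : Fin d × Fin d, G ij * (b ij.1 * a ij.2) := by
    rw [convPoint, Fintype.sum_prod_type]
    exact Finset.sum_congr rfl fun i _ => Finset.sum_congr rfl fun j _ => by ring
  have h2 : ∑ ij : Fin d × Fin d, (b ij.1 * a ij.2) ^ 2 = ‖b‖ ^ 2 * ‖a‖ ^ 2 := by
    simp only [EuclideanSpace.norm_sq_eq, Real.norm_eq_abs, sq_abs]
    rw [Fintype.sum_prod_type, Finset.sum_mul_sum]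
    exact Finset.sum_congr rfl fun i _ => Finset.sum_congr rfl fun j _ => by ring
  have h3 : ∑ ij : Fin d × Fin d, G ij ^ 2 = ‖G‖ ^ 2 := by
    simp only [EuclideanSpace.norm_sq_eq, Real.norm_eq_abs, sq_abs]
  refine abs_le_of_sq_le_sq ?_ (by positivity)
  rw [h1]
  calc _ ≤ (∑ ij : Fin d × Fin d, G ij ^ 2) * ∑ ij : Fin d × Fin d, (b ij.1 * a ij.2) ^ 2 :=
        Finset.sum_mul_sq_le_sq_mul_sq _ _ _
    _ = _ := by rw [h2, h3]; ring

lemma continuous_convPoint :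
    Continuous fun z : Vec d × Mat d × Vec d => convPoint z.1 z.2.1 z.2.2 := by
  unfold convPoint
  fun_prop

lemma conv_eq (u v w : H01 Ω) :
    conv u v w = ∫ x in Ω, convPoint (fn u x) (grad v x) (fn w x) := rfl

/-- The convective integrand is integrable with the natural bound, by Hölder's inequality for the
exponents `4, 2, 4`. -/
lemma integrable_convPoint_and_abs_conv_le {K : NNReal} (hK : HasL4Embedding Ω K)
    (u v w : H01 Ω) :
    Integrable (fun x => convPoint (fn u x) (grad v x) (fn w x)) (volume.restrict Ω) ∧
      |conv u v w| ≤ K ^ 2 * ‖grad u‖ * ‖grad v‖ * ‖grad w‖ := by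
  set μ := volume.restrict Ω
  have hm : AEStronglyMeasurable (fun x => convPoint (fn u x) (grad v x) (fn w x)) μ :=
    continuous_convPoint.comp_aestronglyMeasurable
      (f := fun x => (fn u x, grad v x, fn w x))
      ((Lp.aestronglyMeasurable (fn u)).prodMk
        ((Lp.aestronglyMeasurable (grad v)).prodMk (Lp.aestronglyMeasurable (fn w))))
  have h244 : ENNReal.HolderTriple 4 4 2 := ⟨by
    rw [← two_mul, show (4 : ENNReal) = 2 * 2 by norm_num, ENNReal.mul_inv (by simp) (by simp),
      ← mul_assoc, ENNReal.mul_inv_cancel (by simp) (by simp), one_mul]⟩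
  have h1 : eLpNorm (fun x => ‖fn u x‖ * ‖fn w x‖) 2 μ
      ≤ eLpNorm (fn u) 4 μ * eLpNorm (fn w) 4 μ := by
    have := eLpNorm_smul_le_mul_eLpNorm (p := 4) (q := 4) (r := 2) (μ := μ)
      (φ := fun x => ‖fn u x‖) (f := fun x => ‖fn w x‖)
      (Lp.aestronglyMeasurable _).norm (Lp.aestronglyMeasurable _).norm
    rw [eLpNorm_norm, eLpNorm_norm] at this
    exact this
  have h2 : eLpNorm (fun x => convPoint (fn u x) (grad v x) (fn w x)) 1 μ
      ≤ ENNReal.ofReal (K ^ 2 * ‖grad u‖ * ‖grad v‖ * ‖grad w‖) := by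
    calc _ ≤ eLpNorm (fun x => ‖grad v x‖ * (‖fn u x‖ * ‖fn w x‖)) 1 μ :=
          eLpNorm_mono fun x => by
            rw [Real.norm_eq_abs, Real.norm_eq_abs,
              abs_of_nonneg (a := _ * (_ * _)) (by positivity)]
            exact (abs_convPoint_le _ _ _).trans_eq (by ring)
      _ ≤ eLpNorm (grad v) 2 μ * eLpNorm (fun x => ‖fn u x‖ * ‖fn w x‖) 2 μ := by
          have := eLpNorm_smul_le_mul_eLpNorm (p := 2) (q := 2) (r := 1) (μ := μ)
            (φ := fun x => ‖grad v x‖) (f := fun x => ‖fn u x‖ * ‖fn w x‖)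
            ((Lp.aestronglyMeasurable _).norm.mul (Lp.aestronglyMeasurable _).norm)
            (Lp.aestronglyMeasurable _).norm
          rw [eLpNorm_norm] at this
          exact this
      _ ≤ ‖grad v‖ₑ * ((K * ‖grad u‖ₑ) * (K * ‖grad w‖ₑ)) := by
          rw [← Lp.enorm_def]
          gcongr
          exact h1.trans (mul_le_mul' (hK u) (hK w))
      _ = _ := by
          rw [← ofReal_norm, ← ofReal_norm, ← ofReal_norm,
            ← ENNReal.ofReal_coe_nnreal, ← ENNReal.ofReal_mul (by positivity),
            ← ENNReal.ofReal_mul (by positivity), ← ENNReal.ofReal_mul (by positivity),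
            ← ENNReal.ofReal_mul (by positivity)]
          congr 1; ring
  have hi : Integrable (fun x => convPoint (fn u x) (grad v x) (fn w x)) μ :=
    memLp_one_iff_integrable.1 ⟨hm, h2.trans_lt ENNReal.ofReal_lt_top⟩
  refine ⟨hi, ?_⟩
  rw [conv_eq, ← Real.norm_eq_abs]
  refine (norm_integral_le_integral_norm _).trans ?_
  rw [integral_norm_eq_lintegral_enorm hm, ← eLpNorm_one_eq_lintegral_enorm]
  exact ENNReal.toReal_le_of_le_ofReal (by positivity) h2

variable {K : NNReal} (hK : HasL4Embedding Ω K)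
include hK

lemma conv_add_left (u u' v w : H01 Ω) : conv (u + u') v w = conv u v w + conv u' v w := by
  rw [conv_eq, conv_eq, conv_eq, ← integral_add (integrable_convPoint_and_abs_conv_le hK u v w).1
    (integrable_convPoint_and_abs_conv_le hK u' v w).1]
  refine integral_congr_ae ?_
  filter_upwards [Lp.coeFn_add (fn u) (fn u')] with x hx
  rw [fn_add, hx]
  simp [convPoint, add_mul, Finset.sum_add_distrib]

lemma conv_add_middle (u v v' w : H01 Ω) : conv u (v + v') w = conv u v w + conv u v' w := by
  rw [conv_eq, conv_eq, conv_eq, ← integral_add (integrable_convPoint_and_abs_conv_le hK u v w).1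
    (integrable_convPoint_and_abs_conv_le hK u v' w).1]
  refine integral_congr_ae ?_
  filter_upwards [Lp.coeFn_add (grad v) (grad v')] with x hx
  rw [grad_add, hx]
  simp [convPoint, mul_add, add_mul, Finset.sum_add_distrib]

lemma conv_add_right (u v w w' : H01 Ω) : conv u v (w + w') = conv u v w + conv u v w' := by
  rw [conv_eq, conv_eq, conv_eq, ← integral_add (integrable_convPoint_and_abs_conv_le hK u v w).1
    (integrable_convPoint_and_abs_conv_le hK u v w').1]
  refine integral_congr_ae ?_
  filter_upwards [Lp.coeFn_add (fn w) (fn w')] with x hx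
  rw [fn_add, hx]
  simp [convPoint, mul_add, Finset.sum_add_distrib]

lemma bstar_add_left (u u' v w : H01 Ω) : bstar (u + u') v w = bstar u v w + bstar u' v w := by
  simp only [bstar, conv_add_left hK]; ring

lemma bstar_add_middle (u v v' w : H01 Ω) :
    bstar u (v + v') w = bstar u v w + bstar u v' w := by
  simp only [bstar, conv_add_right hK, conv_add_middle hK]; ring

lemma bstar_add_right (u v w w' : H01 Ω) :
    bstar u v (w + w') = bstar u v w + bstar u v w' := by
  simp only [bstar, conv_add_right hK, conv_add_middle hK]; ring

lemma bstar_neg_right (u v w : H01 Ω) : bstar u v (-w) = -bstar u v w := by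
  have h0 : bstar u v 0 = 0 := by simpa using bstar_add_right hK u v 0 0
  have := bstar_add_right hK u v w (-w)
  rw [add_neg_cancel, h0] at this
  linarith

omit hK in
lemma bstar_self (u w : H01 Ω) : bstar u w w = 0 := by simp [bstar]

omit hK in
lemma grad_neg_norm (w : H01 Ω) : ‖grad (-w)‖ = ‖grad w‖ := norm_neg (grad w)

/-- The difference of the nonlinear terms, for `u = v + η + φ`, tested with `φ`. -/
lemma bstar_diff {u v η φ : H01 Ω} (h : u = v + η + φ) :
    bstar u u φ - bstar v v φ = bstar u η φ + bstar η v φ + bstar φ v φ := by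
  have h1 : bstar u u φ = bstar u (v + η + φ) φ := by rw [← h]
  have h2 : bstar u v φ = bstar (v + η + φ) v φ := by rw [← h]
  rw [bstar_add_middle hK, bstar_add_middle hK, bstar_self] at h1
  rw [bstar_add_left hK, bstar_add_left hK] at h2
  linarith

lemma abs_bstar_le (u v w : H01 Ω) :
    |bstar u v w| ≤ K ^ 2 * ‖grad u‖ * ‖grad v‖ * ‖grad w‖ := by
  have h1 := abs_le.1 (integrable_convPoint_and_abs_conv_le hK u v w).2
  have h2 := abs_le.1 (integrable_convPoint_and_abs_conv_le hK u w v).2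
  have h3 : (K : ℝ) ^ 2 * ‖grad u‖ * ‖grad w‖ * ‖grad v‖
    = K ^ 2 * ‖grad u‖ * ‖grad v‖ * ‖grad w‖ := by ring
  rw [h3] at h2
  rw [bstar, abs_le]
  constructor <;> linarith [h1.1, h1.2, h2.1, h2.2]

/-- The supremum defining `M` is over a bounded set, so that `M` is a constant in the trilinear
estimate. -/
lemma abs_bstar_le_Mconst (u v w : H01 Ω) :
    |bstar u v w| ≤ Mconst Ω * ‖grad u‖ * ‖grad v‖ * ‖grad w‖ := by
  have hb : BddAbove
      {r | ∃ u v w : H01 Ω, r = bstar u v w / (‖grad u‖ * ‖grad v‖ * ‖grad w‖)} := by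
    refine ⟨K ^ 2, ?_⟩
    rintro r ⟨u, v, w, rfl⟩
    refine div_le_of_le_mul₀ (by positivity) (by positivity) ?_
    exact (le_abs_self _).trans ((abs_bstar_le hK u v w).trans_eq (by ring))
  have key : ∀ w, bstar u v w ≤ Mconst Ω * ‖grad u‖ * ‖grad v‖ * ‖grad w‖ := by
    intro w
    by_cases h0 : ‖grad u‖ * ‖grad v‖ * ‖grad w‖ = 0
    · have := (le_abs_self _).trans (abs_bstar_le hK u v w)
      have e1 : (K : ℝ) ^ 2 * ‖grad u‖ * ‖grad v‖ * ‖grad w‖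
        = K ^ 2 * (‖grad u‖ * ‖grad v‖ * ‖grad w‖) := by ring
      have e2 : Mconst Ω * ‖grad u‖ * ‖grad v‖ * ‖grad w‖
        = Mconst Ω * (‖grad u‖ * ‖grad v‖ * ‖grad w‖) := by ring
      rw [e1, h0, mul_zero] at this
      rwa [e2, h0, mul_zero]
    · have hp : 0 < ‖grad u‖ * ‖grad v‖ * ‖grad w‖ := lt_of_le_of_ne (by positivity) (Ne.symm h0)
      have := (div_le_iff₀ hp).1 (le_csSup hb ⟨u, v, w, rfl⟩)
      exact this.trans_eq (by rw [Mconst]; ring)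
  refine abs_le'.2 ⟨key w, ?_⟩
  rw [← bstar_neg_right hK, ← grad_neg_norm w]
  exact key (-w)

lemma abs_bstar_le_of_isTrilinearConstant {C₂ : ℝ} (hC : IsTrilinearConstant Ω C₂)
    (u v w : H01 Ω) :
    |bstar u v w| ≤ |C₂| * √‖fn u‖ * √‖grad u‖ * ‖grad v‖ * ‖grad w‖ := by
  have key : ∀ w, bstar u v w ≤ |C₂| * √‖fn u‖ * √‖grad u‖ * ‖grad v‖ * ‖grad w‖ := fun w =>
    (hC u v w).trans (by gcongr; exact le_abs_self _)
  refine abs_le'.2 ⟨key w, ?_⟩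
  rw [← bstar_neg_right hK, ← grad_neg_norm w]
  exact key (-w)

end Trilinear

/-! ### Weak derivatives of elements of `H¹₀` -/

section WeakDeriv

variable {d : ℕ} {Ω : Set (Vec d)}

lemma multiD_zero (φ : Vec d → ℝ) : multiD 0 φ = φ := by
  rw [multiD]
  induction List.finRange d with
  | nil => rfl
  | cons a l ih => simp

lemma multiD_single (j : Fin d) (φ : Vec d → ℝ) : multiD (Pi.single j 1) φ = partialD j φ := by
  have key : ∀ l : List (Fin d), l.Nodup →
      l.foldr (fun i ψ => (partialD i)^[(Pi.single j 1 : Fin d → ℕ) i] ψ) φ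
        = if j ∈ l then partialD j φ else φ := by
    intro l
    induction l with
    | nil => simp
    | cons a l ih =>
      intro h
      rw [List.nodup_cons] at h
      rw [List.foldr_cons, ih h.2]
      by_cases ha : a = j
      · subst ha; simp [h.1]
      · simp [Ne.symm ha]
  rw [multiD, key _ (List.nodup_finRange d), if_pos (List.mem_finRange j)]

lemma integral_mul_eq_inner {χ : Vec d → ℝ} (hχ : MemLp χ 2 (volume.restrict Ω)) (f : L2 Ω ℝ) :
    ∫ x in Ω, f x * χ x = inner ℝ (hχ.toLp χ) f := by
  rw [L2.inner_def]
  refine integral_congr_ae ?_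
  filter_upwards [hχ.coeFn_toLp] with x hx
  simp [hx]

/-- The entries of `∇u` are the weak derivatives of the components of `u`. -/
lemma isWeakDeriv_grad (w : H01 Ω) (i j : Fin d) :
    IsWeakDeriv (Pi.single j 1) (comp i (fn w))
      ((EuclideanSpace.proj (i, j) : Mat d →L[ℝ] ℝ).compLp (grad w)) := by
  intro φ h1 h2 h3
  have hp : partialD j φ = fun x => fderiv ℝ φ x (EuclideanSpace.single j 1) := rfl
  have hc : Continuous (partialD j φ) := by
    rw [hp]; exact (h1.continuous_fderiv (by simp)).clm_apply continuous_const
  have hcs : HasCompactSupport (partialD j φ) := by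
    rw [hp]; exact (h2.fderiv (𝕜 := ℝ)).comp_left (g := fun L : Vec d →L[ℝ] ℝ => L _) rfl
  have hm : MemLp φ 2 (volume.restrict Ω) :=
    (h1.continuous.memLp_of_hasCompactSupport h2).restrict Ω
  have hm' : MemLp (partialD j φ) 2 (volume.restrict Ω) :=
    (hc.memLp_of_hasCompactSupport hcs).restrict Ω
  rw [multiD_single]
  have hs : ∑ k, (Pi.single j 1 : Fin d → ℕ) k = 1 := by simp
  rw [hs, pow_one, neg_one_mul]
  refine H01_induction (P := fun z => ∫ x in Ω, (comp i z.1) x * partialD j φ x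
    = -∫ x in Ω, ((EuclideanSpace.proj (i, j) : Mat d →L[ℝ] ℝ).compLp z.2) x * φ x) ?_ ?_ w
  · simp only [integral_mul_eq_inner hm, integral_mul_eq_inner hm']
    have e1 : Continuous fun z : L2 Ω (Vec d) × L2 Ω (Mat d) => comp i z.1 :=
      ((EuclideanSpace.proj i : Vec d →L[ℝ] ℝ).compLpL 2
        (volume.restrict Ω)).continuous.comp continuous_fst
    have e2 : Continuous fun z : L2 Ω (Vec d) × L2 Ω (Mat d) =>
        (EuclideanSpace.proj (i, j) : Mat d →L[ℝ] ℝ).compLp z.2 :=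
      ((EuclideanSpace.proj (i, j) : Mat d →L[ℝ] ℝ).compLpL 2
        (volume.restrict Ω)).continuous.comp continuous_snd
    exact isClosed_eq (continuous_const.inner e1) (continuous_const.inner e2).neg
  · rintro z ⟨ψ, k1, k2, k3, k4, k5⟩
    have l1 : ∫ x in Ω, (comp i z.1) x * partialD j φ x = ∫ x in Ω, ψ x i * partialD j φ x := by
      refine integral_congr_ae ?_
      filter_upwards [k4, (EuclideanSpace.proj i : Vec d →L[ℝ] ℝ).coeFn_compLp z.1] with x hx hx'
      rw [comp, hx', hx]; rfl
    have l2 : ∫ x in Ω, ((EuclideanSpace.proj (i, j) : Mat d →L[ℝ] ℝ).compLp z.2) x * φ x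
        = ∫ x in Ω, fderiv ℝ (fun y => ψ y i) x (EuclideanSpace.single j 1) * φ x := by
      refine integral_congr_ae ?_
      filter_upwards [k5, (EuclideanSpace.proj (i, j) : Mat d →L[ℝ] ℝ).coeFn_compLp z.2]
        with x hx hx'
      have hd : fderiv ℝ (fun y => ψ y i) x (EuclideanSpace.single j 1)
          = fderiv ℝ ψ x (EuclideanSpace.single j 1) i := by
        have := ((EuclideanSpace.proj i : Vec d →L[ℝ] ℝ).hasFDerivAt.comp x
          (k1.differentiable (by simp) x).hasFDerivAt).fderiv
        have e : (fun y => ψ y i) = (EuclideanSpace.proj i : Vec d →L[ℝ] ℝ) ∘ ψ := rfl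
        rw [e, this]; rfl
      rw [hx', hx, hd]; rfl
    rw [l1, l2]
    have hψ : ContDiff ℝ (⊤ : ℕ∞) fun y => ψ y i :=
      (EuclideanSpace.proj i : Vec d →L[ℝ] ℝ).contDiff.comp k1
    have hψs : HasCompactSupport fun y => ψ y i :=
      k2.comp_left (g := fun v : Vec d => v i) rfl
    have hz : ∀ x, x ∉ Ω → φ x = 0 := fun x hx => by
      by_contra h
      exact hx (h3 (subset_tsupport _ h))
    have hz' : ∀ x, x ∉ Ω → ψ x i = 0 := fun x hx => by
      by_contra h
      exact hx (k3 (subset_tsupport _ fun h' => h (by simp [h'])))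
    rw [setIntegral_eq_integral_of_forall_compl_eq_zero (fun x hx => by rw [hz' x hx, zero_mul]),
      setIntegral_eq_integral_of_forall_compl_eq_zero (fun x hx => by rw [hz x hx, mul_zero])]
    have hcd : Continuous fun x => fderiv ℝ (fun y => ψ y i) x (EuclideanSpace.single j 1) :=
      (hψ.continuous_fderiv (by simp)).clm_apply continuous_const
    exact integral_mul_fderiv_eq_neg_fderiv_mul_of_integrable
      ((hcd.mul h1.continuous).integrable_of_hasCompactSupport h2.mul_left)
      ((hψ.continuous.mul hc).integrable_of_hasCompactSupport hcs.mul_left)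
      ((hψ.continuous.mul h1.continuous).integrable_of_hasCompactSupport h2.mul_left)
      (fun x _ => hψ.differentiable (by simp) x) (fun x _ => h1.differentiable (by simp) x)

lemma memHVec_one_fn (w : H01 Ω) : MemHVec 1 (fn w) := by
  intro i a ha
  by_cases h0 : a = 0
  · subst h0
    refine ⟨comp i (fn w), fun φ _ _ _ => ?_⟩
    rw [multiD_zero]; simp
  · obtain ⟨j, hj⟩ : ∃ j, a j ≠ 0 := by
      by_contra! h
      exact h0 (funext h)
    have hrest : a = Pi.single j 1 := by
      have h1 := Finset.add_sum_erase Finset.univ a (Finset.mem_univ j)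
      funext k
      by_cases hk : k = j
      · subst hk; rw [Pi.single_eq_same]; omega
      · rw [Pi.single_eq_of_ne hk]
        have := Finset.single_le_sum (f := a) (fun _ _ => Nat.zero_le _)
          (Finset.mem_erase.2 ⟨hk, Finset.mem_univ k⟩)
        omega
    rw [hrest]
    exact ⟨_, isWeakDeriv_grad w i j⟩

end WeakDeriv

/-! ### The observation operator, the divergence, and projections -/

section Operators

variable {d : ℕ} {Ω : Set (Vec d)}

section StarProjection

variable {IH : L2 Ω (Vec d) →L[ℝ] L2 Ω (Vec d)} (hI : IsStarProjection IH)
include hI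

lemma inner_starProjection (x y : L2 Ω (Vec d)) : inner ℝ (IH x) y = inner ℝ (IH x) (IH y) := by
  have h1 : IH (IH x) = IH x := by
    exact congrArg (fun A : L2 Ω (Vec d) →L[ℝ] L2 Ω (Vec d) => A x) hI.isIdempotentElem.eq
  have h2 := (ContinuousLinearMap.isSelfAdjoint_iff_isSymmetric.1 hI.isSelfAdjoint) (IH x) y
  simp only [ContinuousLinearMap.coe_coe] at h2
  rw [h1] at h2
  exact h2

lemma norm_starProjection_le (x : L2 Ω (Vec d)) : ‖IH x‖ ≤ ‖x‖ := by
  have h1 : ‖IH x‖ * ‖IH x‖ ≤ ‖IH x‖ * ‖x‖ := by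
    rw [← real_inner_self_eq_norm_mul_norm, ← inner_starProjection hI]
    exact real_inner_le_norm _ _
  rcases (norm_nonneg (IH x)).eq_or_lt with h | h
  · rw [← h]; exact norm_nonneg _
  · exact le_of_mul_le_mul_left h1 h

lemma norm_sub_starProjection_sq (x : L2 Ω (Vec d)) :
    ‖x - IH x‖ ^ 2 = ‖x‖ ^ 2 - ‖IH x‖ ^ 2 := by
  rw [norm_sub_sq_real, real_inner_comm, inner_starProjection hI, real_inner_self_eq_norm_sq]
  ring

end StarProjection

/-- The first power of `C₃` comes from combining the bound by `C₃` with the bound by `1` that holds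
for every orthogonal projection. -/
lemma IsObservation.norm_sq_le {IH : L2 Ω (Vec d) →L[ℝ] L2 Ω (Vec d)} {H C₁ C₃ : ℝ}
    (hI : IsObservation IH H C₁ C₃) (w : H01 Ω) : ‖IH (fn w)‖ ^ 2 ≤ C₃ * ‖fn w‖ ^ 2 := by
  calc ‖IH (fn w)‖ ^ 2 = ‖IH (fn w)‖ * ‖IH (fn w)‖ := pow_two _
    _ ≤ (C₃ * ‖fn w‖) * ‖fn w‖ :=
      mul_le_mul (hI.bound _ (memHVec_one_fn w)) (norm_starProjection_le hI.proj _)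
        (norm_nonneg _) ((norm_nonneg _).trans (hI.bound _ (memHVec_one_fn w)))
    _ = _ := by ring

lemma norm_dv_le (w : H01 Ω) : ‖dv w‖ ^ 2 ≤ d * ‖grad w‖ ^ 2 := by
  have h1 : ‖dv w‖ ≤ √d * ‖grad w‖ := by
    refine Lp.norm_le_mul_norm_of_ae_le_mul ?_
    filter_upwards [(traceCLM d).coeFn_compLp (grad w)] with x hx
    rw [dv, hx, EuclideanSpace.norm_eq, ← Real.sqrt_mul (by positivity), Real.norm_eq_abs,
      ← Real.sqrt_sq_eq_abs]
    refine Real.sqrt_le_sqrt ?_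
    have e1 : traceCLM d (grad w x) = ∑ i, grad w x (i, i) := by
      simp [traceCLM]
    have e2 : ∑ i, grad w x (i, i) ^ 2 ≤ ∑ ij, ‖grad w x ij‖ ^ 2 := by
      simp only [Real.norm_eq_abs, sq_abs]
      rw [Fintype.sum_prod_type]
      exact Finset.sum_le_sum fun i _ =>
        Finset.single_le_sum (f := fun j => grad w x (i, j) ^ 2) (fun _ _ => sq_nonneg _)
          (Finset.mem_univ i)
    have e3 := sq_sum_le_card_mul_sum_sq (s := (Finset.univ : Finset (Fin d)))
      (f := fun i => grad w x (i, i))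
    rw [Finset.card_univ, Fintype.card_fin] at e3
    rw [e1]
    exact e3.trans (by gcongr)
  calc ‖dv w‖ ^ 2 ≤ (√d * ‖grad w‖) ^ 2 := by gcongr
    _ = _ := by rw [mul_pow, Real.sq_sqrt (by positivity)]

/-- For a continuous linear map `J` into an inner product space and a finite dimensional `V`, there
is a continuous linear map `P` with values in `V` for which `J (P w)` is the orthogonal projection
of `J w` to `J V`. The map `J` need not be injective. -/
lemma exists_projection {X E : Type*} [NormedAddCommGroup X] [NormedSpace ℝ X]
    [NormedAddCommGroup E] [InnerProductSpace ℝ E] (J : X →L[ℝ] E) (V : Submodule ℝ X)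
    [FiniteDimensional ℝ V] :
    ∃ P : X →L[ℝ] X, (∀ w, P w ∈ V) ∧ ∀ w, ∀ y ∈ V, inner ℝ (J (w - P w)) (J y) = 0 := by
  set W := V.map (J : X →ₗ[ℝ] E)
  let JV : V →ₗ[ℝ] W := (J : X →ₗ[ℝ] E).submoduleMap V
  obtain ⟨s, hs⟩ := JV.exists_rightInverse_of_surjective
    (LinearMap.range_eq_top.2 ((J : X →ₗ[ℝ] E).submoduleMap_surjective V))
  refine ⟨V.subtypeL ∘L (LinearMap.toContinuousLinearMap s) ∘L W.orthogonalProjectionOnto ∘L J,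
    fun w => (s _).2, fun w y hy => ?_⟩
  have h1 : J (s (W.orthogonalProjectionOnto (J w)) : X) = W.orthogonalProjectionOnto (J w) :=
    congrArg Subtype.val (LinearMap.congr_fun hs (W.orthogonalProjectionOnto (J w)))
  have h2 : J y ∈ W := ⟨y, hy, rfl⟩
  rw [map_sub]
  have h3 : J ((V.subtypeL ∘L (LinearMap.toContinuousLinearMap s) ∘L
      W.orthogonalProjectionOnto ∘L J) w)
    = W.orthogonalProjectionOnto (J w) := h1
  rw [h3]
  exact W.starProjection_inner_eq_zero _ _ h2

/-- `V^h` as a subspace. -/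
def discDivFreeSubmodule (Xh : Submodule ℝ (H01 Ω)) (Qh : Submodule ℝ (L2 Ω ℝ)) :
    Submodule ℝ (H01 Ω) where
  carrier := discDivFree Xh Qh
  zero_mem' := ⟨Xh.zero_mem, fun q _ => by
    have : dv (0 : H01 Ω) = 0 := ((traceCLM d).compLpL 2 (volume.restrict Ω)).map_zero
    rw [this, inner_zero_left]⟩
  add_mem' := by
    rintro a b ⟨h1, h2⟩ ⟨k1, k2⟩
    refine ⟨Xh.add_mem h1 k1, fun q hq => ?_⟩
    have : dv (a + b) = dv a + dv b :=
      ((traceCLM d).compLpL 2 (volume.restrict Ω)).map_add (grad a) (grad b)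
    rw [this, inner_add_left, h2 q hq, k2 q hq, add_zero]
  smul_mem' := by
    rintro c a ⟨h1, h2⟩
    refine ⟨Xh.smul_mem c h1, fun q hq => ?_⟩
    have : dv (c • a) = c • dv a :=
      ((traceCLM d).compLpL 2 (volume.restrict Ω)).map_smul c (grad a)
    rw [this, inner_smul_left, h2 q hq, mul_zero]

end Operators

/-! ### Absolutely continuous functions of time -/

section Time

variable {E F : Type*} [NormedAddCommGroup E] [NormedSpace ℝ E] [NormedAddCommGroup F]
  [NormedSpace ℝ F]

lemma HasTimeDeriv.clm_comp [CompleteSpace E] [CompleteSpace F] {T : ℝ} {g g' : ℝ → E}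
    (hg : HasTimeDeriv T g g') (hT : 0 ≤ T) (A : E →L[ℝ] F) :
    HasTimeDeriv T (fun t => A (g t)) (fun t => A (g' t)) := by
  refine ⟨⟨A.integrable_comp hg.1.1, A.integrable_comp hg.1.2⟩, fun t ht => ?_⟩
  have h0 : IntervalIntegrable g' volume 0 t :=
    hg.1.mono_set (by rw [uIcc_of_le ht.1, uIcc_of_le hT]; exact Icc_subset_Icc_right ht.2)
  simp only
  rw [hg.2 t ht, map_add, A.intervalIntegral_comp_comm h0]

lemma HasTimeDeriv.sub {T : ℝ} {g g' k k' : ℝ → E}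
    (hg : HasTimeDeriv T g g') (hk : HasTimeDeriv T k k') (hT : 0 ≤ T) :
    HasTimeDeriv T (fun t => g t - k t) (fun t => g' t - k' t) := by
  refine ⟨hg.1.sub hk.1, fun t ht => ?_⟩
  have hs : uIcc 0 t ⊆ uIcc 0 T := by
    rw [uIcc_of_le ht.1, uIcc_of_le hT]; exact Icc_subset_Icc_right ht.2
  simp only
  rw [hg.2 t ht, hk.2 t ht, intervalIntegral.integral_sub (hg.1.mono_set hs) (hk.1.mono_set hs)]
  abel

lemma HasTimeDeriv.continuousOn {T : ℝ} {g g' : ℝ → E} (hg : HasTimeDeriv T g g')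
    (hT : 0 ≤ T) : ContinuousOn g (Icc 0 T) := by
  have h1 : ContinuousOn (fun t => g 0 + ∫ s in (0 : ℝ)..t, g' s) (Icc 0 T) := by
    refine continuousOn_const.add ?_
    have := intervalIntegral.continuousOn_primitive_interval (a := 0) (b := T) (f := g')
      (by rw [uIcc_of_le hT]; exact (intervalIntegrable_iff_integrableOn_Icc_of_le hT).1 hg.1)
    rwa [uIcc_of_le hT] at this
  exact h1.congr hg.2

lemma absolutelyContinuousOnInterval_norm {E : Type*} [NormedAddCommGroup E] {g : ℝ → E} {a b : ℝ}
    (hg : AbsolutelyContinuousOnInterval g a b) :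
    AbsolutelyContinuousOnInterval (fun t => ‖g t‖) a b := by
  refine squeeze_zero (fun t => ?_) (fun t => ?_) hg
  · exact Finset.sum_nonneg fun i _ => by positivity
  · exact Finset.sum_le_sum fun i _ => by
      rw [dist_eq_norm (g _)]
      exact abs_norm_sub_norm_le _ _

/-- The indefinite integral of a vector valued function is absolutely continuous, because that of
the norm of the function is. -/
lemma absolutelyContinuousOnInterval_primitive {f : ℝ → E} {a b : ℝ}
    (hf : IntervalIntegrable f volume a b) :
    AbsolutelyContinuousOnInterval (fun t => ∫ s in a..t, f s) a b := by
  have h1 := hf.norm.absolutelyContinuousOnInterval_intervalIntegral (c := a) left_mem_uIcc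
  refine squeeze_zero' (Filter.Eventually.of_forall fun I =>
    Finset.sum_nonneg fun i _ => dist_nonneg) ?_ h1
  refine Filter.eventually_inf_principal.2 (Filter.Eventually.of_forall fun I hI => ?_)
  refine Finset.sum_le_sum fun i hi => ?_
  have hx := (hI.1 i hi).1
  have hy := (hI.1 i hi).2
  have hint : ∀ {x : ℝ}, x ∈ uIcc a b → IntervalIntegrable f volume a x := fun h =>
    hf.mono_set (uIcc_subset_uIcc left_mem_uIcc h)
  rw [dist_eq_norm, intervalIntegral.integral_interval_sub_left (hint hx) (hint hy),
    Real.dist_eq, intervalIntegral.integral_interval_sub_left (hint hx).norm (hint hy).norm]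
  exact intervalIntegral.norm_integral_le_abs_integral_norm

end Time

section Energy

variable {E : Type*} [NormedAddCommGroup E] [InnerProductSpace ℝ E] [CompleteSpace E]

/-- The energy identity: the chain rule for `s ↦ exp (β s) ‖g s‖²`, which is absolutely continuous
when `g` is, in integrated form. -/
lemma HasTimeDeriv.energy_identity {T : ℝ} {g g' : ℝ → E} (hg : HasTimeDeriv T g g') (β : ℝ)
    {t : ℝ} (ht : t ∈ Icc 0 T) :
    IntervalIntegrable
      (fun s => Real.exp (β * s) * (2 * inner ℝ (g s) (g' s) + β * ‖g s‖ ^ 2)) volume 0 t ∧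
    ∫ s in (0 : ℝ)..t, Real.exp (β * s) * (2 * inner ℝ (g s) (g' s) + β * ‖g s‖ ^ 2)
      = Real.exp (β * t) * ‖g t‖ ^ 2 - ‖g 0‖ ^ 2 := by
  have hT : 0 ≤ T := ht.1.trans ht.2
  have hs : uIcc 0 t ⊆ uIcc 0 T := by
    rw [uIcc_of_le ht.1, uIcc_of_le hT]; exact Icc_subset_Icc_right ht.2
  have hi := hg.1.mono_set hs
  set G : ℝ → E := fun t => g 0 + ∫ s in (0 : ℝ)..t, g' s with hG
  have hGg : ∀ s ∈ Icc 0 t, g s = G s := fun s h => hg.2 s ⟨h.1, h.2.trans ht.2⟩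
  have hGac : AbsolutelyContinuousOnInterval G 0 t := by
    have h1 := absolutelyContinuousOnInterval_primitive hi
    have h2 : AbsolutelyContinuousOnInterval (fun _ : ℝ => g 0) 0 t :=
      (contDiff_const.contDiffOn).absolutelyContinuousOnInterval
    exact h2.add h1
  have hN : AbsolutelyContinuousOnInterval
      (fun s => Real.exp (β * s) * (‖G s‖ * ‖G s‖)) 0 t := by
    have he : AbsolutelyContinuousOnInterval (fun s => Real.exp (β * s)) 0 t :=
      (ContDiff.contDiffOn (by fun_prop)).absolutelyContinuousOnInterval
    have hn := absolutelyContinuousOnInterval_norm hGac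
    exact he.mul (hn.mul hn)
  have hd : ∀ᵐ s, s ∈ uIoc 0 t →
      deriv (fun s => Real.exp (β * s) * (‖G s‖ * ‖G s‖)) s
        = Real.exp (β * s) * (2 * inner ℝ (g s) (g' s) + β * ‖g s‖ ^ 2) := by
    filter_upwards [hi.ae_hasDerivAt_integral] with s h hst
    have hst' := uIoc_subset_uIcc hst
    have h1 : HasDerivAt G (g' s) s := by
      simpa [hG] using (h hst' 0 (by simp)).const_add (g 0)
    have h2 := h1.norm_sq
    have h3 : HasDerivAt (fun s => Real.exp (β * s)) (Real.exp (β * s) * β) s := by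
      simpa using ((hasDerivAt_id s).const_mul β).exp
    have h4 := (h3.mul h2).deriv
    rw [uIcc_of_le ht.1] at hst'
    have h5 : (fun s => Real.exp (β * s) * (‖G s‖ * ‖G s‖))
        = (fun s => Real.exp (β * s)) * fun s => ‖G s‖ ^ 2 := by
      ext s; simp [pow_two]
    rw [h5, h4, hGg s hst']
    ring
  constructor
  · refine hN.intervalIntegrable_deriv.congr_ae ?_
    rw [Filter.EventuallyEq, ae_restrict_iff' measurableSet_uIoc]
    exact hd
  · rw [← intervalIntegral.integral_congr_ae hd, hN.integral_deriv_eq_sub,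
      ← hGg t ⟨ht.1, le_rfl⟩, ← hGg 0 ⟨le_rfl, ht.1⟩]
    simp [pow_two]

/-- Gronwall's inequality for an energy inequality with dissipation `D`: the decay rate `β` turns
the constant part `G₀` of the source into `G₀ / β`, and the rest `G₁` is only integrated. -/
lemma HasTimeDeriv.gronwall {T : ℝ} {g g' : ℝ → E} (hg : HasTimeDeriv T g g') {β : ℝ}
    (hβ : 0 < β) {t : ℝ} (ht : t ∈ Icc 0 T) {D G₁ : ℝ → ℝ} {G₀ : ℝ} (hG₀ : 0 ≤ G₀)
    (hD : IntervalIntegrable D volume 0 t) (hG₁ : IntervalIntegrable G₁ volume 0 t)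
    (hG₁0 : ∀ s, 0 ≤ G₁ s)
    (hle : ∀ᵐ s ∂volume.restrict (Ioc 0 T),
      2 * inner ℝ (g s) (g' s) + β * ‖g s‖ ^ 2 + D s ≤ G₀ + G₁ s) :
    ‖g t‖ ^ 2 + ∫ s in (0 : ℝ)..t, Real.exp (-β * (t - s)) * D s
      ≤ Real.exp (-β * t) * ‖g 0‖ ^ 2 + G₀ / β + ∫ s in (0 : ℝ)..t, G₁ s := by
  obtain ⟨hi, hid⟩ := hg.energy_identity β ht
  have hec : Continuous fun s => Real.exp (β * s) := by fun_prop
  have hD' : IntervalIntegrable (fun s => Real.exp (β * s) * D s) volume 0 t :=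
    hD.continuousOn_mul hec.continuousOn
  have h0 : IntervalIntegrable (fun s => Real.exp (β * s) * G₀) volume 0 t :=
    (hec.mul continuous_const).intervalIntegrable _ _
  have h1 : IntervalIntegrable (fun s => Real.exp (β * t) * G₁ s) volume 0 t := hG₁.const_mul _
  have hmono := intervalIntegral.integral_mono_ae_restrict ht.1 (hi.add hD') (h0.add h1) (by
    have hsub : volume.restrict (Icc 0 t) ≤ volume.restrict (Icc 0 T) :=
      Measure.restrict_mono (Icc_subset_Icc_right ht.2) le_rfl
    rw [← restrict_Ioc_eq_restrict_Icc (a := 0) (b := T)] at hsub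
    filter_upwards [hsub.absolutelyContinuous.ae_le hle,
      ae_restrict_mem measurableSet_Icc] with s hs hst
    have e1 : Real.exp (β * s) ≤ Real.exp (β * t) :=
      Real.exp_le_exp.2 (mul_le_mul_of_nonneg_left hst.2 hβ.le)
    have e2 := mul_le_mul_of_nonneg_left hs (Real.exp_pos (β * s)).le
    have e3 := mul_le_mul_of_nonneg_right e1 (hG₁0 s)
    linarith)
  rw [intervalIntegral.integral_add hi hD', intervalIntegral.integral_add h0 h1, hid,
    intervalIntegral.integral_mul_const, intervalIntegral.integral_const_mul] at hmono
  have hexp : ∫ s in (0 : ℝ)..t, Real.exp (β * s) = (Real.exp (β * t) - 1) / β := by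
    rw [intervalIntegral.integral_comp_mul_left (fun x => Real.exp x) hβ.ne', integral_exp]
    simp [div_eq_inv_mul]
  have hshift : ∫ s in (0 : ℝ)..t, Real.exp (-β * (t - s)) * D s
      = Real.exp (-β * t) * ∫ s in (0 : ℝ)..t, Real.exp (β * s) * D s := by
    rw [← intervalIntegral.integral_const_mul]
    refine intervalIntegral.integral_congr fun s _ => ?_
    rw [← mul_assoc, ← Real.exp_add]
    congr 2; ring
  have hG : (Real.exp (β * t) - 1) / β * G₀ ≤ Real.exp (β * t) * (G₀ / β) := by
    rw [div_mul_eq_mul_div, mul_div_assoc']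
    gcongr
    linarith
  rw [hexp] at hmono
  have hpos := Real.exp_pos (-β * t)
  have hinv : Real.exp (-β * t) * Real.exp (β * t) = 1 := by
    rw [← Real.exp_add]; simp
  have hfin := mul_le_mul_of_nonneg_left (hmono.trans (add_le_add_left hG _)) hpos.le
  rw [hshift]
  have e : ∀ x : ℝ, Real.exp (-β * t) * (Real.exp (β * t) * x) = x := fun x => by
    rw [← mul_assoc, hinv, one_mul]
  simp only [mul_add, mul_sub, e] at hfin
  linarith

/-- The fundamental theorem of calculus for `‖g‖²`, read backwards in time. -/
lemma HasTimeDeriv.norm_sq_zero_le {T : ℝ} {g g' : ℝ → E} (hg : HasTimeDeriv T g g')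
    {t : ℝ} (ht : t ∈ Icc 0 T) {a b : ℝ} {k₁ k₂ : ℝ → ℝ} (ha : 0 ≤ a) (hk₁0 : ∀ s, 0 ≤ k₁ s)
    (hk₁ : IntervalIntegrable k₁ volume 0 T) (hk₂ : IntervalIntegrable k₂ volume 0 T)
    (hle : ∀ᵐ s ∂volume.restrict (Ioc 0 T),
      -(2 * inner ℝ (g s) (g' s)) ≤ a * k₁ s + b * k₂ s) :
    ‖g 0‖ ^ 2 ≤ ‖g t‖ ^ 2 + a * (∫ s in (0 : ℝ)..T, k₁ s) + b * ∫ s in (0 : ℝ)..t, k₂ s := by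
  have hsub : uIcc 0 t ⊆ uIcc 0 T := by
    rw [uIcc_of_le ht.1, uIcc_of_le (ht.1.trans ht.2)]; exact Icc_subset_Icc_right ht.2
  obtain ⟨hi, hid⟩ := hg.energy_identity 0 ht
  simp only [zero_mul, Real.exp_zero, one_mul, add_zero] at hi hid
  have j₁ := (hk₁.mono_set hsub).const_mul a
  have j₂ := (hk₂.mono_set hsub).const_mul b
  have hmono := intervalIntegral.integral_mono_ae_restrict ht.1 hi.neg (j₁.add j₂) (by
    have hsub : volume.restrict (Icc 0 t) ≤ volume.restrict (Icc 0 T) :=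
      Measure.restrict_mono (Icc_subset_Icc_right ht.2) le_rfl
    rw [← restrict_Ioc_eq_restrict_Icc (a := 0) (b := T)] at hsub
    exact hsub.absolutelyContinuous.ae_le hle)
  have hneg : ∫ s in (0 : ℝ)..t, (-fun s => 2 * inner ℝ (g s) (g' s)) s
      = -(‖g t‖ ^ 2 - ‖g 0‖ ^ 2) := by
    rw [← hid, ← intervalIntegral.integral_neg]; rfl
  rw [hneg, intervalIntegral.integral_add j₁ j₂, intervalIntegral.integral_const_mul,
    intervalIntegral.integral_const_mul] at hmono
  have h := mul_le_mul_of_nonneg_left (intervalIntegral.integral_mono_interval le_rfl ht.1 ht.2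
    (Filter.Eventually.of_forall hk₁0) hk₁) ha
  linarith

end Energy

/-! ### The energy inequality for the discrete part of the error -/

lemma two_mul_le_young {ε : ℝ} (hε : 0 < ε) (x y : ℝ) : 2 * (x * y) ≤ ε * x ^ 2 + y ^ 2 / ε := by
  have h : ε * x ^ 2 + y ^ 2 / ε - 2 * (x * y) = (ε * x - y) ^ 2 / ε := by
    field_simp; ring
  have := div_nonneg (sq_nonneg (ε * x - y)) hε.le
  linarith

/-- Young's inequality for `c ‖φ‖^{1/2} ‖∇φ‖^{3/2}`, in two steps. The weights `2/21 + 1/21 = 1/7`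
give the constant `9261/16`, half of the one in the condition on `χ`. -/
lemma young_three_fourths {ν a g c : ℝ} (hν : 0 < ν) (ha : 0 ≤ a) (hg : 0 ≤ g) :
    2 * (c * √a * √g * g) ≤ ν / 7 * g ^ 2 + c ^ 4 * (9261 / 8) * (ν ^ 3)⁻¹ * a ^ 2 := by
  have h1 := two_mul_le_young (ε := 2 / 21 * ν) (by positivity) g (c * √a * √g)
  have h2 := two_mul_le_young (ε := 1 / 21 * ν) (by positivity) g (21 / (4 * ν) * c ^ 2 * a)
  have e1 : (c * √a * √g) ^ 2 = c ^ 2 * a * g := by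
    rw [mul_pow, mul_pow, Real.sq_sqrt ha, Real.sq_sqrt hg]
  rw [e1] at h1
  have e2 : c ^ 2 * a * g / (2 / 21 * ν) = 2 * (g * (21 / (4 * ν) * c ^ 2 * a)) := by
    field_simp; ring
  have e3 : (21 / (4 * ν) * c ^ 2 * a) ^ 2 / (1 / 21 * ν)
      = 1 / 2 * (c ^ 4 * (9261 / 8) * (ν ^ 3)⁻¹ * a ^ 2) := by
    field_simp; ring
  have h3 : 0 ≤ c ^ 4 * (9261 / 8) * (ν ^ 3)⁻¹ * a ^ 2 := by positivity
  rw [e2] at h1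
  rw [e3] at h2
  have e4 : c * √a * √g * g = g * (c * √a * √g) := by ring
  rw [e4]
  linarith

section Pointwise

variable {d : ℕ} {Ω : Set (Vec d)}

set_option maxHeartbeats 4000000 in
/-- The energy inequality at a fixed time, for `u = v + η + φ` with `φ ∈ V^h`. The viscous term
`2 ν ‖∇φ‖²` pays `ν` for the passage from `‖I_H φ‖` to `‖φ‖`, `ν / 7` for `b*(φ, v, φ)`, `3 ν / 14`
for the term `ω R(u)`, and `ν / 70` for each of the five remaining terms. -/
lemma energy_inequality_at_time {K : NNReal} (hK : HasL4Embedding Ω K) (hd : d ≤ 3)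
    {ν ω χ α H C₁ C₂ C₃ S Nt Np : ℝ} (hν : 0 < ν) (hχ : 0 < χ) (hH : 0 < H)
    (hC₁ : 0 < C₁) (hC₂ : IsTrilinearConstant Ω C₂)
    {Xh : Submodule ℝ (H01 Ω)} {Qh : Submodule ℝ (L2 Ω ℝ)}
    {IH : L2 Ω (Vec d) →L[ℝ] L2 Ω (Vec d)} {R : L2 Ω (Vec d) → L2 Ω (Vec d)}
    (hI : IsObservation IH H C₁ C₃) (hR : IsCoriolisLike R)
    (hS : α * χ ≤ χ - C₂ ^ 4 * (9261 / 8) * (ν ^ 3)⁻¹ * S ^ 4)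
    (hνH : 0 < ν - C₁ ^ 2 * H ^ 2 * χ)
    {f : H01 Ω →L[ℝ] ℝ} {u u_t v v_t η η_t φ φ_t : H01 Ω} {p lam : L2 Ω ℝ}
    (hu : u = v + η + φ) (hu_t : u_t = v_t + η_t + φ_t) (hφ : φ ∈ discDivFree Xh Qh)
    (hlam : lam ∈ Qh) (hvS : ‖grad v‖ ≤ S)
    (hmu : ∀ w : H01 Ω,
      inner ℝ (fn u_t) (fn w) + bstar u u w + ν * inner ℝ (grad u) (grad w)
        - inner ℝ p (dv w) + inner ℝ (ω • R (fn u)) (fn w) = f w)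
    (hmv : ∀ w ∈ Xh,
      inner ℝ (fn v_t) (fn w) + bstar v v w + ν * inner ℝ (grad v) (grad w)
        - inner ℝ lam (dv w) + χ * inner ℝ (IH (fn v - fn u)) (fn w) = f w)
    (hNt : |inner ℝ (fn η_t) (fn φ)| ≤ Nt * ‖grad φ‖)
    (hNp : |inner ℝ p (dv φ)| ≤ Np * ‖dv φ‖) :
    2 * inner ℝ (fn φ) (fn φ_t) + α * χ * ‖fn φ‖ ^ 2 + 4 / 7 * ν * ‖grad φ‖ ^ 2
      ≤ 3 * χ * ‖IH (fn η)‖ ^ 2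
        + (ω ^ 2 * (3 / 2 * (1 / χ) + 14 / 3 * (C₁ ^ 2 * H ^ 2 / ν)) * ‖fn u‖ ^ 2
        + 70 / ν * Mconst Ω ^ 2 * ((‖grad v‖ ^ 2 + ‖grad u‖ ^ 2) * ‖grad η‖ ^ 2)
        + 210 / ν * Np ^ 2 + 70 / ν * Nt ^ 2 + 70 * ν * ‖grad η‖ ^ 2) := by
  set a := ‖fn φ‖
  set g := ‖grad φ‖
  set i := ‖IH (fn φ)‖
  have ha : 0 ≤ a := norm_nonneg _
  have hg : 0 ≤ g := norm_nonneg _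
  have hi0 : 0 ≤ i := norm_nonneg _
  -- the error equation tested with `φ`
  have hlam0 : inner ℝ lam (dv φ) = 0 := by rw [real_inner_comm]; exact hφ.2 lam hlam
  have h1 := hmu φ
  have h2 := hmv φ hφ.1
  have hb := bstar_diff hK hu
  have et : inner ℝ (fn u_t) (fn φ)
      = inner ℝ (fn v_t) (fn φ) + inner ℝ (fn η_t) (fn φ) + inner ℝ (fn φ) (fn φ_t) := by
    rw [hu_t, fn_add, fn_add, inner_add_left, inner_add_left, real_inner_comm (fn φ) (fn φ_t)]
  have eg : inner ℝ (grad u) (grad φ)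
      = inner ℝ (grad v) (grad φ) + inner ℝ (grad η) (grad φ) + g ^ 2 := by
    rw [hu, grad_add, grad_add, inner_add_left, inner_add_left,
      real_inner_self_eq_norm_sq (grad φ)]
  have eI : inner ℝ (IH (fn v - fn u)) (fn φ) = -inner ℝ (IH (fn η)) (IH (fn φ)) - i ^ 2 := by
    have : fn v - fn u = -fn η - fn φ := by rw [hu, fn_add, fn_add]; abel
    rw [this, map_sub, map_neg, inner_sub_left, inner_neg_left, inner_starProjection hI.proj,
      inner_starProjection hI.proj (fn φ), real_inner_self_eq_norm_sq]
  have eR : inner ℝ (ω • R (fn u)) (fn φ)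
      = ω * inner ℝ (R (fn u)) (IH (fn φ)) + ω * inner ℝ (R (fn u)) (fn φ - IH (fn φ)) := by
    rw [inner_smul_left, ← mul_add, ← inner_add_right, add_sub_cancel]; rfl
  rw [et, eg, eR] at h1
  rw [eI] at h2
  -- the bounds of the individual terms
  have hID : ‖fn φ - IH (fn φ)‖ ≤ C₁ * H * g := hI.approx φ
  have hIi : a ^ 2 - C₁ ^ 2 * H ^ 2 * g ^ 2 ≤ i ^ 2 := by
    have h := norm_sub_starProjection_sq hI.proj (fn φ)
    have h' : ‖fn φ - IH (fn φ)‖ ^ 2 ≤ (C₁ * H * g) ^ 2 := by gcongr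
    rw [h] at h'
    linarith [mul_pow (C₁ * H) g 2, mul_pow C₁ H 2, h',
      (by ring : (C₁ * H * g) ^ 2 = C₁ ^ 2 * H ^ 2 * g ^ 2)]
  have hconv : χ * a ^ 2 - ν * g ^ 2 ≤ χ * i ^ 2 := by
    have h := mul_le_mul_of_nonneg_left hIi hχ.le
    have h' := mul_nonneg hνH.le (sq_nonneg g)
    linarith
  have y1 : -(2 * inner ℝ (fn η_t) (fn φ)) ≤ ν / 70 * g ^ 2 + 70 / ν * Nt ^ 2 := by
    have h := two_mul_le_young (ε := ν / 70) (by positivity) g Nt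
    have h' := (abs_le.1 hNt).1
    have e : Nt ^ 2 / (ν / 70) = 70 / ν * Nt ^ 2 := by field_simp
    linarith
  have y2 : ∀ z y : H01 Ω, |bstar z y φ| ≤ Mconst Ω * ‖grad z‖ * ‖grad y‖ * g →
      -(2 * bstar z y φ)
        ≤ ν / 70 * g ^ 2 + 70 / ν * Mconst Ω ^ 2 * (‖grad z‖ ^ 2 * ‖grad y‖ ^ 2) := by
    intro z y hzy
    have h := two_mul_le_young (ε := ν / 70) (by positivity) g (Mconst Ω * ‖grad z‖ * ‖grad y‖)
    have h' := (abs_le.1 hzy).1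
    have e : (Mconst Ω * ‖grad z‖ * ‖grad y‖) ^ 2 / (ν / 70)
      = 70 / ν * Mconst Ω ^ 2 * (‖grad z‖ ^ 2 * ‖grad y‖ ^ 2) := by field_simp
    linarith
  have y3 := y2 u η (abs_bstar_le_Mconst hK u η φ)
  have y4 := y2 η v (abs_bstar_le_Mconst hK η v φ)
  have y5 : -(2 * bstar φ v φ) ≤ ν / 7 * g ^ 2 + (1 - α) * χ * a ^ 2 := by
    have h := (abs_le.1 (abs_bstar_le_of_isTrilinearConstant hK hC₂ φ v φ)).1
    have hS0 : 0 ≤ S := (norm_nonneg _).trans hvS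
    have hle : |C₂| * √a * √g * ‖grad v‖ * g ≤ |C₂| * S * √a * √g * g := by
      have : |C₂| * √a * √g * ‖grad v‖ * g ≤ |C₂| * √a * √g * S * g := by gcongr
      exact this.trans_eq (by ring)
    have hy := young_three_fourths (c := |C₂| * S) hν ha hg
    have e : (|C₂| * S) ^ 4 * (9261 / 8) * (ν ^ 3)⁻¹ * a ^ 2
        = (C₂ ^ 4 * (9261 / 8) * (ν ^ 3)⁻¹ * S ^ 4) * a ^ 2 := by
      rw [mul_pow, Even.pow_abs (by decide)]; ring
    have h' : (C₂ ^ 4 * (9261 / 8) * (ν ^ 3)⁻¹ * S ^ 4) * a ^ 2 ≤ (1 - α) * χ * a ^ 2 :=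
      mul_le_mul_of_nonneg_right (by linarith) (sq_nonneg a)
    linarith
  have y6 : -(2 * (ν * inner ℝ (grad η) (grad φ))) ≤ ν / 70 * g ^ 2 + 70 * ν * ‖grad η‖ ^ 2 := by
    have h := two_mul_le_young (ε := ν / 70) (by positivity) g (ν * ‖grad η‖)
    have h' := (abs_le.1 (abs_real_inner_le_norm (grad η) (grad φ))).1
    have h'' := mul_le_mul_of_nonneg_left h' hν.le
    have e : (ν * ‖grad η‖) ^ 2 / (ν / 70) = 70 * ν * ‖grad η‖ ^ 2 := by field_simp
    linarith
  have y7 : 2 * inner ℝ p (dv φ) ≤ ν / 70 * g ^ 2 + 210 / ν * Np ^ 2 := by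
    have h := two_mul_le_young (ε := ν / 210) (by positivity) ‖dv φ‖ Np
    have h' := (abs_le.1 hNp).2
    have e : Np ^ 2 / (ν / 210) = 210 / ν * Np ^ 2 := by field_simp
    have hd3 : ‖dv φ‖ ^ 2 ≤ 3 * g ^ 2 := (norm_dv_le φ).trans (by gcongr; exact_mod_cast hd)
    have h'' := mul_le_mul_of_nonneg_left hd3 (by positivity : 0 ≤ ν / 210)
    linarith
  have hRu := (hR u).2
  have y8 : -(2 * (ω * inner ℝ (R (fn u)) (IH (fn φ))))
      ≤ 2 / 3 * χ * i ^ 2 + ω ^ 2 * (3 / 2 * (1 / χ)) * ‖fn u‖ ^ 2 := by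
    have h := two_mul_le_young (ε := 2 / 3 * χ) (by positivity) i (|ω| * ‖fn u‖)
    have h' : |ω * inner ℝ (R (fn u)) (IH (fn φ))| ≤ |ω| * (‖fn u‖ * i) := by
      rw [abs_mul]
      exact mul_le_mul_of_nonneg_left ((abs_real_inner_le_norm _ _).trans
        (mul_le_mul_of_nonneg_right hRu hi0)) (abs_nonneg _)
    have h'' := (abs_le.1 h').1
    have e : (|ω| * ‖fn u‖) ^ 2 / (2 / 3 * χ) = ω ^ 2 * (3 / 2 * (1 / χ)) * ‖fn u‖ ^ 2 := by
      rw [mul_pow, sq_abs]; field_simp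
    linarith
  have y9 : -(2 * (ω * inner ℝ (R (fn u)) (fn φ - IH (fn φ))))
      ≤ 3 / 14 * ν * g ^ 2 + ω ^ 2 * (14 / 3 * (C₁ ^ 2 * H ^ 2 / ν)) * ‖fn u‖ ^ 2 := by
    have h := two_mul_le_young (ε := 3 / 14 * ν) (by positivity) g (|ω| * ‖fn u‖ * (C₁ * H))
    have h' : |ω * inner ℝ (R (fn u)) (fn φ - IH (fn φ))| ≤ |ω| * (‖fn u‖ * (C₁ * H * g)) := by
      rw [abs_mul]
      exact mul_le_mul_of_nonneg_left ((abs_real_inner_le_norm _ _).trans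
        (mul_le_mul hRu hID (norm_nonneg _) (norm_nonneg _))) (abs_nonneg _)
    have h'' := (abs_le.1 h').1
    have e : (|ω| * ‖fn u‖ * (C₁ * H)) ^ 2 / (3 / 14 * ν)
        = ω ^ 2 * (14 / 3 * (C₁ ^ 2 * H ^ 2 / ν)) * ‖fn u‖ ^ 2 := by
      rw [mul_pow, mul_pow, sq_abs]; field_simp
    linarith
  have y10 : -(2 * (χ * inner ℝ (IH (fn η)) (IH (fn φ))))
      ≤ 1 / 3 * χ * i ^ 2 + 3 * χ * ‖IH (fn η)‖ ^ 2 := by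
    have h := two_mul_le_young (ε := 1 / 3 * χ) (by positivity) i (χ * ‖IH (fn η)‖)
    have h' := (abs_le.1 (abs_real_inner_le_norm (IH (fn η)) (IH (fn φ)))).1
    have h'' := mul_le_mul_of_nonneg_left h' hχ.le
    have e : (χ * ‖IH (fn η)‖) ^ 2 / (1 / 3 * χ) = 3 * χ * ‖IH (fn η)‖ ^ 2 := by field_simp
    linarith
  linarith

end Pointwise

/-! ### The integrated estimate -/

lemma bochnerNorm_four_sq {E : Type*} [NormedAddCommGroup E] {T : ℝ} (hT : 0 ≤ T) (g : ℝ → E) :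
    bochnerNorm 4 T g ^ 2 = √(∫ t in (0 : ℝ)..T, ‖g t‖ ^ 4) := by
  have h0 : 0 ≤ ∫ t in (0 : ℝ)..T, ‖g t‖ ^ 4 :=
    intervalIntegral.integral_nonneg hT fun _ _ => by positivity
  rw [bochnerNorm, ← Real.rpow_natCast, ← Real.rpow_mul h0, Real.sqrt_eq_rpow]
  norm_num

lemma bochnerNorm_two_sq {E : Type*} [NormedAddCommGroup E] {T : ℝ} (hT : 0 ≤ T) (g : ℝ → E) :
    bochnerNorm 2 T g ^ 2 = ∫ t in (0 : ℝ)..T, ‖g t‖ ^ 2 := by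
  have h0 : 0 ≤ ∫ t in (0 : ℝ)..T, ‖g t‖ ^ 2 :=
    intervalIntegral.integral_nonneg hT fun _ _ => by positivity
  rw [bochnerNorm, ← Real.rpow_natCast, ← Real.rpow_mul h0]
  norm_num

lemma intervalIntegral_mul_le_sqrt_mul_sqrt {T : ℝ} (hT : 0 ≤ T) {a b : ℝ → ℝ}
    (ha : ∀ s, 0 ≤ a s) (hb : ∀ s, 0 ≤ b s)
    (ham : AEStronglyMeasurable a (volume.restrict (Ioc 0 T)))
    (hbm : AEStronglyMeasurable b (volume.restrict (Ioc 0 T)))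
    (hai : IntegrableOn (fun s => a s ^ 2) (Ioc 0 T))
    (hbi : IntegrableOn (fun s => b s ^ 2) (Ioc 0 T)) :
    IntervalIntegrable (fun s => a s * b s) volume 0 T ∧
    ∫ s in (0 : ℝ)..T, a s * b s
      ≤ √(∫ s in (0 : ℝ)..T, a s ^ 2) * √(∫ s in (0 : ℝ)..T, b s ^ 2) := by
  have h1 : MemLp a 2 (volume.restrict (Ioc 0 T)) := (memLp_two_iff_integrable_sq ham).2 hai
  have h2 : MemLp b 2 (volume.restrict (Ioc 0 T)) := (memLp_two_iff_integrable_sq hbm).2 hbi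
  refine ⟨(intervalIntegrable_iff_integrableOn_Ioc_of_le hT).2 (h1.integrable_mul h2), ?_⟩
  simp only [intervalIntegral.integral_of_le hT]
  have h2' : ENNReal.ofReal 2 = 2 := by norm_num
  have := integral_mul_le_Lp_mul_Lq_of_nonneg (μ := volume.restrict (Ioc 0 T))
    Real.HolderConjugate.two_two (Filter.Eventually.of_forall ha)
    (Filter.Eventually.of_forall hb) (by rwa [h2']) (by rwa [h2'])
  simpa [Real.sqrt_eq_rpow] using this

/-- Integration of a linear combination of nonnegative functions, where all integrals but one are
extended to the full time interval. -/
lemma intervalIntegral_combination_le {T t a b c d e : ℝ} (ht : t ∈ Icc 0 T)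
    {A B₁ B₂ Q W X : ℝ → ℝ} (hA : ∀ s, 0 ≤ A s) (hB₁ : ∀ s, 0 ≤ B₁ s) (hB₂ : ∀ s, 0 ≤ B₂ s)
    (hQ : ∀ s, 0 ≤ Q s) (hX : ∀ s, 0 ≤ X s)
    (iA : IntervalIntegrable A volume 0 T) (iB₁ : IntervalIntegrable B₁ volume 0 T)
    (iB₂ : IntervalIntegrable B₂ volume 0 T) (iQ : IntervalIntegrable Q volume 0 T)
    (iW : IntervalIntegrable W volume 0 T) (iX : IntervalIntegrable X volume 0 T)
    (ha : 0 ≤ a) (hb : 0 ≤ b) (hc : 0 ≤ c) (he : 0 ≤ e) :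
    ∫ s in (0 : ℝ)..t, (a * A s + b * (B₁ s + B₂ s) + c * Q s + d * W s + e * X s)
      ≤ a * (∫ s in (0 : ℝ)..T, A s)
        + b * ((∫ s in (0 : ℝ)..T, B₁ s) + ∫ s in (0 : ℝ)..T, B₂ s)
        + c * (∫ s in (0 : ℝ)..T, Q s) + d * (∫ s in (0 : ℝ)..t, W s)
        + e * ∫ s in (0 : ℝ)..T, X s := by
  have hsub : uIcc 0 t ⊆ uIcc 0 T := by
    rw [uIcc_of_le ht.1, uIcc_of_le (ht.1.trans ht.2)]; exact Icc_subset_Icc_right ht.2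
  have hmono : ∀ {k : ℝ → ℝ}, IntervalIntegrable k volume 0 T → (∀ s, 0 ≤ k s) →
      ∫ s in (0 : ℝ)..t, k s ≤ ∫ s in (0 : ℝ)..T, k s := fun hk h0 =>
    intervalIntegral.integral_mono_interval le_rfl ht.1 ht.2
      (Filter.Eventually.of_forall h0) hk
  have jA := (iA.mono_set hsub).const_mul a
  have jB := ((iB₁.mono_set hsub).add (iB₂.mono_set hsub)).const_mul b
  have jQ := (iQ.mono_set hsub).const_mul c
  have jW := (iW.mono_set hsub).const_mul d
  have jX := (iX.mono_set hsub).const_mul e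
  rw [intervalIntegral.integral_add (((jA.add jB).add jQ).add jW) jX,
    intervalIntegral.integral_add ((jA.add jB).add jQ) jW,
    intervalIntegral.integral_add (jA.add jB) jQ, intervalIntegral.integral_add jA jB]
  simp only [intervalIntegral.integral_const_mul]
  rw [intervalIntegral.integral_add (iB₁.mono_set hsub) (iB₂.mono_set hsub)]
  gcongr
  · exact hmono iA hA
  · exact hmono iB₁ hB₁
  · exact hmono iB₂ hB₂
  · exact hmono iQ hQ
  · exact hmono iX hX

/-- The hypotheses on the exact and the nudged solution, and on the discretization. -/
structure ErrorSetting {d : ℕ} (Ω : Set (Vec d)) (T ν ω χ α h H C C₁ C₂ C₃ : ℝ) (m : ℕ)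
    (Xh : Submodule ℝ (H01 Ω)) (Qh : Submodule ℝ (L2 Ω ℝ))
    (IH : L2 Ω (Vec d) →L[ℝ] L2 Ω (Vec d)) (R : L2 Ω (Vec d) → L2 Ω (Vec d))
    (f : ℝ → (H01 Ω →L[ℝ] ℝ)) (u u_t v v_t : ℝ → H01 Ω) (p lam : ℝ → L2 Ω ℝ) : Prop where
  dim : d = 2 ∨ d = 3
  bounded : Bornology.IsBounded Ω
  T_pos : 0 < T
  ν_pos : 0 < ν
  χ_pos : 0 < χ
  α_pos : 0 < α
  h_pos : 0 < h
  H_pos : 0 < H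
  C_pos : 0 < C
  C₁_pos : 0 < C₁
  C₃_pos : 0 < C₃
  trilinear : IsTrilinearConstant Ω C₂
  finite : FiniteDimensional ℝ Xh
  approx : ApproxProperty Xh Qh m h C
  observation : IsObservation IH H C₁ C₃
  coriolis : IsCoriolisLike R
  exact_sol : IsNSESolution Ω T ν ω R f u u_t p
  regular : HasSobolevRegularity m T u u_t p
  nudged_sol : IsNudgedSolution Xh Qh T ν χ IH f u v v_t lam
  χ_large : α * χ ≤ χ - C₂ ^ 4 * (9261 / 8) * (ν ^ 3)⁻¹ * supNorm T (fun s => grad (v s)) ^ 4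
  H_small : 0 < ν - C₁ ^ 2 * H ^ 2 * χ

/-- A time independent linear projection `P` onto `V^h` whose error `η = u - P u` has the optimal
order, and for which the functional `(η_t, ·)` on `V^h` is of order `h^{m+2}` in the dual of the
gradient norm. -/
structure IsGoodProjection {d : ℕ} {Ω : Set (Vec d)} (Xh : Submodule ℝ (H01 Ω))
    (Qh : Submodule ℝ (L2 Ω ℝ)) (m : ℕ) (h C T : ℝ) (u u_t : ℝ → H01 Ω)
    (P : H01 Ω →L[ℝ] H01 Ω) : Prop where
  mem : ∀ w, P w ∈ discDivFree Xh Qh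
  approx_fn : ∀ s ∈ Icc 0 T,
    ‖fn (u s - P (u s))‖ ≤ C * h ^ (m + 1) * semiVec (m + 1) (fn (u s))
  approx_grad : ∀ s ∈ Icc 0 T,
    ‖grad (u s - P (u s))‖ ≤ C * h ^ m * semiVec (m + 1) (fn (u s))
  approx_deriv : ∀ᵐ s ∂volume.restrict (Ioc 0 T), ∀ y ∈ discDivFree Xh Qh,
    |inner ℝ (fn (u_t s - P (u_t s))) (fn y)|
      ≤ C * h ^ (m + 2) * semiVec (m + 1) (fn (u_t s)) * ‖grad y‖

section Setting

variable {d : ℕ} {Ω : Set (Vec d)} {T ν ω χ α h H C C₁ C₂ C₃ : ℝ} {m : ℕ}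
  {Xh : Submodule ℝ (H01 Ω)} {Qh : Submodule ℝ (L2 Ω ℝ)}
  {IH : L2 Ω (Vec d) →L[ℝ] L2 Ω (Vec d)} {R : L2 Ω (Vec d) → L2 Ω (Vec d)}
  {f : ℝ → (H01 Ω →L[ℝ] ℝ)} {u u_t v v_t : ℝ → H01 Ω} {p lam : ℝ → L2 Ω ℝ}

lemma semiVec_nonneg (k : ℕ) (w : L2 Ω (Vec d)) : 0 ≤ semiVec k w := Real.sqrt_nonneg _

/-- The functional `(p, ∇·φ)` on `V^h` only sees the distance of `p` to `Q^h`. -/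
lemma abs_inner_dv_le (ha : ApproxProperty Xh Qh m h C) {q : L2 Ω ℝ} (hq : q ∈ meanZero Ω)
    (hqm : MemH m q) {φ : H01 Ω} (hφ : φ ∈ discDivFree Xh Qh) :
    |inner ℝ q (dv φ)| ≤ C * h ^ m * semi m q * ‖dv φ‖ := by
  refine le_trans ?_ (mul_le_mul_of_nonneg_right (ha.2 q hq hqm) (norm_nonneg _))
  rw [Real.iInf_mul_of_nonneg (norm_nonneg _)]
  refine le_ciInf fun r => ?_
  have : inner ℝ q (dv φ) = inner ℝ (q - r.1) (dv φ) := by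
    rw [inner_sub_left, real_inner_comm (dv φ) r.1, hφ.2 r.1 r.2, sub_zero]
  rw [this]
  exact abs_real_inner_le_norm _ _

variable (S : ErrorSetting Ω T ν ω χ α h H C C₁ C₂ C₃ m Xh Qh IH R f u u_t v v_t p lam)
include S

lemma ErrorSetting.continuousOn_u : ContinuousOn u (Icc 0 T) :=
  S.exact_sol.timeDeriv.continuousOn S.T_pos.le

lemma ErrorSetting.continuousOn_v : ContinuousOn v (Icc 0 T) :=
  S.nudged_sol.timeDeriv.continuousOn S.T_pos.le

lemma ErrorSetting.norm_grad_v_le {s : ℝ} (hs : s ∈ Icc 0 T) :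
    ‖grad (v s)‖ ≤ supNorm T fun s => grad (v s) := by
  have hc : ContinuousOn (fun s => ‖grad (v s)‖) (Icc 0 T) :=
    ((gradCLM Ω).continuous.comp_continuousOn S.continuousOn_v).norm
  have hb : BddAbove (Set.range fun s : Icc (0 : ℝ) T => ‖grad (v s)‖) := by
    have := isCompact_Icc.bddAbove_image hc
    rwa [image_eq_range] at this
  exact le_ciSup hb ⟨s, hs⟩

lemma ErrorSetting.semiVec_sq_le {s : ℝ} (hs : s ∈ Icc 0 T) :
    semiVec (m + 1) (fn (u s)) ^ 2
      ≤ ⨆ s : Icc (0 : ℝ) T, semiVec (m + 1) (fn (u s)) ^ 2 := by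
  have hb := S.regular.bdd_u
  rw [image_eq_range] at hb
  exact le_ciSup (f := fun s : Icc (0 : ℝ) T => semiVec (m + 1) (fn (u s)) ^ 2) hb ⟨s, hs⟩

lemma ErrorSetting.aestronglyMeasurable_semiVec_sq :
    AEStronglyMeasurable (fun s => semiVec (m + 1) (fn (u s)) ^ 2)
      (volume.restrict (Ioc 0 T)) := by
  have := Real.continuous_sqrt.comp_aestronglyMeasurable S.regular.int_u.aestronglyMeasurable
  refine this.congr (Filter.Eventually.of_forall fun s => ?_)
  have e : semiVec (m + 1) (fn (u s)) ^ 4 = (semiVec (m + 1) (fn (u s)) ^ 2) ^ 2 := by ring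
  simp only
  rw [e, Real.sqrt_sq (by positivity)]

lemma ErrorSetting.intervalIntegrable_semiVec_sq :
    IntervalIntegrable (fun s => semiVec (m + 1) (fn (u s)) ^ 2) volume 0 T := by
  rw [intervalIntegrable_iff_integrableOn_Ioc_of_le S.T_pos.le]
  refine Integrable.mono' (integrable_const
    (⨆ s : Icc (0 : ℝ) T, semiVec (m + 1) (fn (u s)) ^ 2))
    S.aestronglyMeasurable_semiVec_sq ?_
  filter_upwards [ae_restrict_mem measurableSet_Ioc] with s hs
  rw [Real.norm_eq_abs, abs_of_nonneg (by positivity)]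
  exact S.semiVec_sq_le ⟨hs.1.le, hs.2⟩

/-- The Cauchy-Schwarz inequality in time for the products from the nonlinear term. -/
lemma ErrorSetting.integral_grad_mul_semiVec_le {w : ℝ → H01 Ω}
    (hw : ContinuousOn w (Icc 0 T)) :
    IntervalIntegrable (fun s => ‖grad (w s)‖ ^ 2 * semiVec (m + 1) (fn (u s)) ^ 2) volume 0 T ∧
    ∫ s in (0 : ℝ)..T, ‖grad (w s)‖ ^ 2 * semiVec (m + 1) (fn (u s)) ^ 2
      ≤ bochnerNorm 4 T (fun s => grad (w s)) ^ 2
        * √(∫ s in (0 : ℝ)..T, semiVec (m + 1) (fn (u s)) ^ 4) := by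
  have hc : ContinuousOn (fun s => ‖grad (w s)‖ ^ 2) (Icc 0 T) :=
    ((gradCLM Ω).continuous.comp_continuousOn hw).norm.pow 2
  have h1 := intervalIntegral_mul_le_sqrt_mul_sqrt S.T_pos.le (a := fun s => ‖grad (w s)‖ ^ 2)
    (b := fun s => semiVec (m + 1) (fn (u s)) ^ 2) (fun s => by positivity)
    (fun s => by positivity)
    ((hc.mono Ioc_subset_Icc_self).aestronglyMeasurable measurableSet_Ioc)
    S.aestronglyMeasurable_semiVec_sq
    ((hc.pow 2).integrableOn_Icc.mono_set Ioc_subset_Icc_self)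
    (by simpa only [← pow_mul] using S.regular.int_u)
  rw [bochnerNorm_four_sq S.T_pos.le]
  simpa only [← pow_mul] using h1

variable {P : H01 Ω →L[ℝ] H01 Ω}

set_option maxHeartbeats 4000000 in
/-- Gronwall's inequality for the discrete part `φ = P u - v` of the error. -/
lemma ErrorSetting.discrete_error_le (hP : IsGoodProjection Xh Qh m h C T u u_t P)
    {t : ℝ} (ht : t ∈ Icc 0 T) :
    ‖fn (P (u t) - v t)‖ ^ 2 + ∫ s in (0 : ℝ)..t,
        Real.exp (-(α / 2 * χ) * (t - s)) * (4 / 7 * ν * ‖grad (P (u s) - v s)‖ ^ 2)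
      ≤ Real.exp (-(α / 2 * χ) * t) * ‖fn (P (u 0) - v 0)‖ ^ 2
        + 3 * χ * C₃ * C ^ 2 * h ^ (2 * m + 2)
            * (⨆ s : Icc (0 : ℝ) T, semiVec (m + 1) (fn (u s)) ^ 2) / (α / 2 * χ)
        + ∫ s in (0 : ℝ)..t,
          (ω ^ 2 * (3 / 2 * (1 / χ) + 14 / 3 * (C₁ ^ 2 * H ^ 2 / ν)) * ‖fn (u s)‖ ^ 2
          + 70 / ν * Mconst Ω ^ 2 * C ^ 2 * h ^ (2 * m)
            * (‖grad (v s)‖ ^ 2 * semiVec (m + 1) (fn (u s)) ^ 2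
              + ‖grad (u s)‖ ^ 2 * semiVec (m + 1) (fn (u s)) ^ 2)
          + 210 / ν * C ^ 2 * h ^ (2 * m) * semi m (p s) ^ 2
          + 70 / ν * C ^ 2 * h ^ (2 * m + 4) * semiVec (m + 1) (fn (u_t s)) ^ 2
          + 70 * ν * C ^ 2 * h ^ (2 * m) * semiVec (m + 1) (fn (u s)) ^ 2) := by
  obtain ⟨K, hK⟩ := exists_eLpNorm_four_le S.dim S.bounded
  have hT := S.T_pos.le
  have hν := S.ν_pos
  have hχ := S.χ_pos
  have hα := S.α_pos
  have hC₃ := S.C₃_pos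
  have hsub : uIcc 0 t ⊆ uIcc 0 T := by
    rw [uIcc_of_le ht.1, uIcc_of_le hT]; exact Icc_subset_Icc_right ht.2
  have hIoc : ∀ {k : ℝ → ℝ}, IntegrableOn k (Ioc 0 T) → IntervalIntegrable k volume 0 t :=
    fun hk => ((intervalIntegrable_iff_integrableOn_Ioc_of_le hT).2 hk).mono_set hsub
  have hφd : HasTimeDeriv T (fun s => P (u s) - v s) (fun s => P (u_t s) - v_t s) :=
    (S.exact_sol.timeDeriv.clm_comp hT P).sub S.nudged_sol.timeDeriv hT
  have hfn := hφd.clm_comp hT (fnCLM Ω)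
  have hφc := hφd.continuousOn hT
  have hcont : ∀ {k : ℝ → ℝ}, ContinuousOn k (Icc 0 T) → IntervalIntegrable k volume 0 t :=
    fun hk => (hk.mono (by
      rw [uIcc_of_le ht.1]; exact Icc_subset_Icc_right ht.2)).intervalIntegrable
  refine hfn.gronwall (β := α / 2 * χ) (by positivity) ht ?_ ?_ ?_ ?_ ?_
  · have := (S.semiVec_sq_le (left_mem_Icc.2 hT))
    have h0 : 0 ≤ ⨆ s : Icc (0 : ℝ) T, semiVec (m + 1) (fn (u s)) ^ 2 :=
      (sq_nonneg _).trans this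
    have := S.h_pos
    positivity
  · exact hcont ((((gradCLM Ω).continuous.comp_continuousOn hφc).norm.pow 2).const_mul _)
  · refine ((((IntervalIntegrable.const_mul ?_ _).add (IntervalIntegrable.const_mul ?_ _)).add
      (IntervalIntegrable.const_mul ?_ _)).add (IntervalIntegrable.const_mul ?_ _)).add
      (IntervalIntegrable.const_mul ?_ _)
    · exact hcont (((fnCLM Ω).continuous.comp_continuousOn S.continuousOn_u).norm.pow 2)
    · exact ((S.integral_grad_mul_semiVec_le S.continuousOn_v).1.mono_set hsub).add
        ((S.integral_grad_mul_semiVec_le S.continuousOn_u).1.mono_set hsub)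
    · exact hIoc S.regular.int_p
    · exact hIoc S.regular.int_u_t
    · exact S.intervalIntegrable_semiVec_sq.mono_set hsub
  · intro s
    have := S.h_pos
    positivity
  · filter_upwards [S.exact_sol.mean_p, S.exact_sol.momentum, S.regular.mem_p,
      S.nudged_sol.momentum, hP.approx_deriv, ae_restrict_mem measurableSet_Ioc]
      with s hs1 hs2 hs3 hs4 hs5 hs
    have hsI : s ∈ Icc 0 T := ⟨hs.1.le, hs.2⟩
    have hφm : P (u s) - v s ∈ discDivFree Xh Qh :=
      (discDivFreeSubmodule Xh Qh).sub_mem (hP.mem _)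
        ⟨S.nudged_sol.mem_v s hsI, S.nudged_sol.div_v s hsI⟩
    have key := energy_inequality_at_time hK (by rcases S.dim with h | h <;> omega) hν hχ
      S.H_pos S.C₁_pos S.trilinear S.observation S.coriolis S.χ_large S.H_small
      (η := u s - P (u s)) (η_t := u_t s - P (u_t s)) (φ := P (u s) - v s)
      (φ_t := P (u_t s) - v_t s) (by abel) (by abel) hφm (S.nudged_sol.mem_lam s hs)
      (S.norm_grad_v_le hsI) hs2 hs4 (hs5 _ hφm) (abs_inner_dv_le S.approx hs1 hs3 hφm)
    have b1 : ‖fn (u s - P (u s))‖ ^ 2 ≤ C ^ 2 * h ^ (2 * m + 2) * semiVec (m + 1) (fn (u s)) ^ 2 :=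
      (pow_le_pow_left₀ (norm_nonneg _) (hP.approx_fn s hsI) 2).trans_eq (by ring)
    have b2 : ‖grad (u s - P (u s))‖ ^ 2 ≤ C ^ 2 * h ^ (2 * m) * semiVec (m + 1) (fn (u s)) ^ 2 :=
      (pow_le_pow_left₀ (norm_nonneg _) (hP.approx_grad s hsI) 2).trans_eq (by ring)
    have b3 : ‖IH (fn (u s - P (u s)))‖ ^ 2 ≤ C₃ * (C ^ 2 * h ^ (2 * m + 2)
        * ⨆ s : Icc (0 : ℝ) T, semiVec (m + 1) (fn (u s)) ^ 2) := by
      refine (S.observation.norm_sq_le _).trans (mul_le_mul_of_nonneg_left ?_ hC₃.le)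
      refine b1.trans (mul_le_mul_of_nonneg_left (S.semiVec_sq_le hsI) ?_)
      have := S.h_pos
      positivity
    have c1 := mul_le_mul_of_nonneg_left b3 (by positivity : 0 ≤ 3 * χ)
    have c2 := mul_le_mul_of_nonneg_left b2
      (by positivity : 0 ≤ 70 / ν * Mconst Ω ^ 2 * (‖grad (v s)‖ ^ 2 + ‖grad (u s)‖ ^ 2))
    have c3 := mul_le_mul_of_nonneg_left b2 (by positivity : 0 ≤ 70 * ν)
    have c4 : α / 2 * χ * ‖fn (P (u s) - v s)‖ ^ 2 ≤ α * χ * ‖fn (P (u s) - v s)‖ ^ 2 := by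
      gcongr; linarith
    have e1 : 210 / ν * (C * h ^ m * semi m (p s)) ^ 2
      = 210 / ν * C ^ 2 * h ^ (2 * m) * semi m (p s) ^ 2 := by ring
    have e2 : 70 / ν * (C * h ^ (m + 2) * semiVec (m + 1) (fn (u_t s))) ^ 2
      = 70 / ν * C ^ 2 * h ^ (2 * m + 4) * semiVec (m + 1) (fn (u_t s)) ^ 2 := by ring
    simp only [fnCLM_apply]
    linarith

set_option maxHeartbeats 4000000 in
/-- The bound of `ErrorSetting.discrete_error_le`, with the source integrated term by term. -/
lemma ErrorSetting.discrete_error_le_bochnerNorm (hP : IsGoodProjection Xh Qh m h C T u u_t P)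
    {t : ℝ} (ht : t ∈ Icc 0 T) :
    ‖fn (P (u t) - v t)‖ ^ 2 + ∫ s in (0 : ℝ)..t,
        Real.exp (-(α / 2 * χ) * (t - s)) * (4 / 7 * ν * ‖grad (P (u s) - v s)‖ ^ 2)
      ≤ Real.exp (-(α / 2 * χ) * t) * ‖fn (P (u 0) - v 0)‖ ^ 2
        + 3 * (C₃ * C ^ 2 * (2 / α) * h ^ (2 * m + 2)
            * (⨆ s : Icc (0 : ℝ) T, semiVec (m + 1) (fn (u s)) ^ 2))
        + ω ^ 2 * (3 / 2 * (1 / χ) + 14 / 3 * (C₁ ^ 2 * H ^ 2 / ν))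
            * bochnerNorm 2 T (fun s => fn (u s)) ^ 2
        + 70 / ν * Mconst Ω ^ 2
          * (bochnerNorm 4 T (fun s => grad (v s)) ^ 2 + bochnerNorm 4 T (fun s => grad (u s)) ^ 2)
          * (C ^ 2 * h ^ (2 * m) * √(∫ s in (0 : ℝ)..T, semiVec (m + 1) (fn (u s)) ^ 4))
        + 210 / ν * C ^ 2 * h ^ (2 * m) * (∫ s in (0 : ℝ)..T, semi m (p s) ^ 2)
        + 70 / ν * C ^ 2 * h ^ (2 * m + 4)
          * (∫ s in (0 : ℝ)..t, semiVec (m + 1) (fn (u_t s)) ^ 2)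
        + 70 * ν * C ^ 2 * h ^ (2 * m)
          * (∫ s in (0 : ℝ)..T, semiVec (m + 1) (fn (u s)) ^ 2) := by
  refine (S.discrete_error_le hP ht).trans ?_
  have hT := S.T_pos.le
  have hν := S.ν_pos
  have hχ := S.χ_pos
  have hα := S.α_pos
  have hh := S.h_pos
  have i1 : IntervalIntegrable (fun s => ‖fn (u s)‖ ^ 2) volume 0 T := by
    refine ContinuousOn.intervalIntegrable ?_
    rw [uIcc_of_le hT]
    exact ((fnCLM Ω).continuous.comp_continuousOn S.continuousOn_u).norm.pow 2
  obtain ⟨i2, j2⟩ := S.integral_grad_mul_semiVec_le S.continuousOn_v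
  obtain ⟨i3, j3⟩ := S.integral_grad_mul_semiVec_le S.continuousOn_u
  have i4 : IntervalIntegrable (fun s => semi m (p s) ^ 2) volume 0 T :=
    (intervalIntegrable_iff_integrableOn_Ioc_of_le hT).2 S.regular.int_p
  have i5 : IntervalIntegrable (fun s => semiVec (m + 1) (fn (u_t s)) ^ 2) volume 0 T :=
    (intervalIntegrable_iff_integrableOn_Ioc_of_le hT).2 S.regular.int_u_t
  have i6 := S.intervalIntegrable_semiVec_sq
  have key := intervalIntegral_combination_le ht (fun s => sq_nonneg ‖fn (u s)‖)
    (fun s => mul_nonneg (sq_nonneg ‖grad (v s)‖) (sq_nonneg (semiVec (m + 1) (fn (u s)))))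
    (fun s => mul_nonneg (sq_nonneg ‖grad (u s)‖) (sq_nonneg (semiVec (m + 1) (fn (u s)))))
    (fun s => sq_nonneg (semi m (p s))) (fun s => sq_nonneg (semiVec (m + 1) (fn (u s))))
    i1 i2 i3 i4 i5 i6
    (a := ω ^ 2 * (3 / 2 * (1 / χ) + 14 / 3 * (C₁ ^ 2 * H ^ 2 / ν)))
    (b := 70 / ν * Mconst Ω ^ 2 * C ^ 2 * h ^ (2 * m)) (c := 210 / ν * C ^ 2 * h ^ (2 * m))
    (d := 70 / ν * C ^ 2 * h ^ (2 * m + 4)) (e := 70 * ν * C ^ 2 * h ^ (2 * m))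
    (by positivity) (by positivity) (by positivity) (by positivity)
  have q2 := mul_le_mul_of_nonneg_left (add_le_add j2 j3)
    (by positivity : 0 ≤ 70 / ν * Mconst Ω ^ 2 * C ^ 2 * h ^ (2 * m))
  have e : 3 * χ * C₃ * C ^ 2 * h ^ (2 * m + 2)
        * (⨆ s : Icc (0 : ℝ) T, semiVec (m + 1) (fn (u s)) ^ 2) / (α / 2 * χ)
      = 3 * (C₃ * C ^ 2 * (2 / α) * h ^ (2 * m + 2)
          * (⨆ s : Icc (0 : ℝ) T, semiVec (m + 1) (fn (u s)) ^ 2)) := by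
    field_simp
  rw [bochnerNorm_two_sq hT]
  linarith

set_option maxHeartbeats 4000000 in
/-- The dissipation of the error is that of `φ`, up to the factor `8 / 7` for which there is room,
and that of the projection error. -/
lemma ErrorSetting.dissipation_le (hP : IsGoodProjection Xh Qh m h C T u u_t P)
    {t : ℝ} (ht : t ∈ Icc 0 T) :
    ν / 2 * ∫ s in (0 : ℝ)..t, Real.exp (-(α / 2 * χ) * (t - s)) * ‖grad (u s - v s)‖ ^ 2
      ≤ (∫ s in (0 : ℝ)..t,
        Real.exp (-(α / 2 * χ) * (t - s)) * (4 / 7 * ν * ‖grad (P (u s) - v s)‖ ^ 2))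
        + 4 * ν * C ^ 2 * h ^ (2 * m)
          * (∫ s in (0 : ℝ)..T, semiVec (m + 1) (fn (u s)) ^ 2) := by
  have hT := S.T_pos.le
  have hν := S.ν_pos
  have hχ := S.χ_pos
  have hα := S.α_pos
  have hh := S.h_pos
  have hsub : uIcc 0 t ⊆ uIcc 0 T := by
    rw [uIcc_of_le ht.1, uIcc_of_le hT]; exact Icc_subset_Icc_right ht.2
  have hec : Continuous fun s => Real.exp (-(α / 2 * χ) * (t - s)) := by fun_prop
  have hint : ∀ {w : ℝ → H01 Ω}, ContinuousOn w (Icc 0 T) → ∀ k : ℝ, IntervalIntegrable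
      (fun s => Real.exp (-(α / 2 * χ) * (t - s)) * (k * ‖grad (w s)‖ ^ 2)) volume 0 t := by
    intro w hw k
    refine ContinuousOn.intervalIntegrable ?_
    refine ContinuousOn.mono ?_ hsub
    rw [uIcc_of_le hT]
    exact hec.continuousOn.mul
      ((((gradCLM Ω).continuous.comp_continuousOn hw).norm.pow 2).const_mul _)
  have hφ : ContinuousOn (fun s => P (u s) - v s) (Icc 0 T) :=
    (P.continuous.comp_continuousOn S.continuousOn_u).sub S.continuousOn_v
  have i6 := S.intervalIntegrable_semiVec_sq.const_mul (4 * ν * C ^ 2 * h ^ (2 * m))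
  have hle := intervalIntegral.integral_mono_on ht.1
    (hint (S.continuousOn_u.sub S.continuousOn_v) (ν / 2))
    ((hint hφ (4 / 7 * ν)).add (i6.mono_set hsub)) (by
    intro s hs
    have hsI : s ∈ Icc 0 T := ⟨hs.1, hs.2.trans ht.2⟩
    have b2 : ‖grad (u s - P (u s))‖ ^ 2
        ≤ C ^ 2 * h ^ (2 * m) * semiVec (m + 1) (fn (u s)) ^ 2 :=
      (pow_le_pow_left₀ (norm_nonneg _) (hP.approx_grad s hsI) 2).trans_eq (by ring)
    have e : grad (u s - v s) = grad (P (u s) - v s) + grad (u s - P (u s)) := by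
      rw [← grad_add]; congr 1; abel
    have b3 : ‖grad (u s - v s)‖ ^ 2
        ≤ 8 / 7 * ‖grad (P (u s) - v s)‖ ^ 2 + 8 * ‖grad (u s - P (u s))‖ ^ 2 := by
      have h1 := norm_add_le (grad (P (u s) - v s)) (grad (u s - P (u s)))
      rw [← e] at h1
      have h2 := pow_le_pow_left₀ (norm_nonneg _) h1 2
      have h3 := two_mul_le_young (ε := 1 / 7) (by norm_num) ‖grad (P (u s) - v s)‖
        ‖grad (u s - P (u s))‖
      linarith
    have hE0 := Real.exp_pos (-(α / 2 * χ) * (t - s))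
    have hE1 : Real.exp (-(α / 2 * χ) * (t - s)) ≤ 1 := by
      rw [Real.exp_le_one_iff]
      have : 0 ≤ α / 2 * χ * (t - s) := mul_nonneg (by positivity) (by linarith [hs.2])
      linarith
    have c1 := mul_le_mul_of_nonneg_left b3
      (by positivity : 0 ≤ Real.exp (-(α / 2 * χ) * (t - s)) * (ν / 2))
    have c2 := mul_le_mul hE1 (mul_le_mul_of_nonneg_left b2 (by positivity : 0 ≤ 4 * ν))
      (by positivity) zero_le_one
    simp only [Pi.sub_apply]
    linarith)
  rw [intervalIntegral.integral_add (hint hφ _) (i6.mono_set hsub),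
    intervalIntegral.integral_const_mul (4 * ν * C ^ 2 * h ^ (2 * m))] at hle
  have hl : ν / 2 * ∫ s in (0 : ℝ)..t,
        Real.exp (-(α / 2 * χ) * (t - s)) * ‖grad (u s - v s)‖ ^ 2
      = ∫ s in (0 : ℝ)..t,
        Real.exp (-(α / 2 * χ) * (t - s)) * (ν / 2 * ‖grad (u s - v s)‖ ^ 2) := by
    rw [← intervalIntegral.integral_const_mul]
    exact intervalIntegral.integral_congr fun s _ => by ring
  rw [hl]
  refine hle.trans (add_le_add_right (mul_le_mul_of_nonneg_left ?_ (by positivity)) _)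
  exact intervalIntegral.integral_mono_interval le_rfl ht.1 ht.2
    (Filter.Eventually.of_forall fun s => by positivity) S.intervalIntegrable_semiVec_sq

end Setting

/-! ### The two projections -/

lemma norm_le_norm_map_add_of_orthogonal {X E : Type*} [NormedAddCommGroup X] [NormedSpace ℝ X]
    [NormedAddCommGroup E] [InnerProductSpace ℝ E] (J : X →L[ℝ] E) {a b : X}
    (h : inner ℝ (J a) (J b) = 0) : ‖J a‖ ≤ ‖J (a + b)‖ := by
  refine le_of_sq_le_sq ?_ (norm_nonneg _)
  rw [map_add, norm_add_sq_real, h]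
  have := sq_nonneg ‖J b‖
  linarith

lemma le_and_le_of_sq_eq_add {N a b : ℝ} (hN : 0 ≤ N) (h : N ^ 2 = a ^ 2 + b ^ 2) :
    a ≤ N ∧ b ≤ N :=
  ⟨le_of_sq_le_sq (by rw [h]; exact le_add_of_nonneg_right (sq_nonneg _)) hN,
    le_of_sq_le_sq (by rw [h]; exact le_add_of_nonneg_left (sq_nonneg _)) hN⟩

lemma le_add_of_sq_eq_add {N a b : ℝ} (ha : 0 ≤ a) (hb : 0 ≤ b) (h : N ^ 2 = a ^ 2 + b ^ 2) :
    N ≤ a + b := by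
  refine le_of_sq_le_sq ?_ (add_nonneg ha hb)
  rw [h, add_sq]
  have := mul_nonneg ha hb
  linarith

section Projections

variable {d : ℕ} {Ω : Set (Vec d)} {T ν ω χ α h H C C₁ C₂ C₃ : ℝ} {m : ℕ}
  {Xh : Submodule ℝ (H01 Ω)} {Qh : Submodule ℝ (L2 Ω ℝ)}
  {IH : L2 Ω (Vec d) →L[ℝ] L2 Ω (Vec d)} {R : L2 Ω (Vec d) → L2 Ω (Vec d)}
  {f : ℝ → (H01 Ω →L[ℝ] ℝ)} {u u_t v v_t : ℝ → H01 Ω} {p lam : ℝ → L2 Ω ℝ}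

instance instFiniteDimensionalDiscDivFree [FiniteDimensional ℝ Xh] :
    FiniteDimensional ℝ (discDivFreeSubmodule Xh Qh) :=
  Submodule.finiteDimensional_of_le (S₂ := Xh) fun _ hw => hw.1

/-- `w ↦ (w, h ∇w)`, the embedding of `X` in the Hilbert space `L² × L²` that carries the scaled
`H¹` inner product `(v, w) + h² (∇v, ∇w)`. -/
noncomputable def scaledEmbedding (Ω : Set (Vec d)) (h : ℝ) :
    H01 Ω →L[ℝ] WithLp 2 (L2 Ω (Vec d) × L2 Ω (Mat d)) :=
  ((WithLp.prodContinuousLinearEquiv 2 ℝ (L2 Ω (Vec d)) (L2 Ω (Mat d))).symm :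
    (L2 Ω (Vec d) × L2 Ω (Mat d)) →L[ℝ] WithLp 2 (L2 Ω (Vec d) × L2 Ω (Mat d))).comp
    ((fnCLM Ω).prod (h • gradCLM Ω))

lemma inner_scaledEmbedding (h : ℝ) (w y : H01 Ω) :
    inner ℝ (scaledEmbedding Ω h w) (scaledEmbedding Ω h y)
      = inner ℝ (fn w) (fn y) + h ^ 2 * inner ℝ (grad w) (grad y) := by
  have : inner ℝ (scaledEmbedding Ω h w) (scaledEmbedding Ω h y)
      = inner ℝ (fn w) (fn y) + inner ℝ (h • grad w) (h • grad y) :=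
    WithLp.prod_inner_apply _ _
  rw [this, inner_smul_left, inner_smul_right]
  simp only [RCLike.conj_to_real]
  ring

lemma norm_scaledEmbedding_sq (h : ℝ) (w : H01 Ω) :
    ‖scaledEmbedding Ω h w‖ ^ 2 = ‖fn w‖ ^ 2 + (h * ‖grad w‖) ^ 2 := by
  rw [← real_inner_self_eq_norm_sq, inner_scaledEmbedding, real_inner_self_eq_norm_sq,
    real_inner_self_eq_norm_sq, mul_pow]

set_option maxHeartbeats 1000000 in
/-- The orthogonal projection onto `V^h` for the scaled `H¹` inner product minimizes the scaled
`H¹` norm, and so inherits the approximation property of `V^h`. -/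
lemma norm_scaledEmbedding_sub_le (hh : 0 < h) (ha : ApproxProperty Xh Qh m h C)
    {P : H01 Ω →L[ℝ] H01 Ω} (hP : ∀ w, P w ∈ discDivFree Xh Qh)
    (hPo : ∀ w, ∀ y ∈ discDivFree Xh Qh,
      inner ℝ (scaledEmbedding Ω h (w - P w)) (scaledEmbedding Ω h y) = 0)
    {w : H01 Ω} (hw : w ∈ divFree Ω) (hwm : MemHVec (m + 1) (fn w)) :
    ‖scaledEmbedding Ω h (w - P w)‖ ≤ C * h ^ (m + 1) * semiVec (m + 1) (fn w) := by
  have : Nonempty (discDivFree Xh Qh) := ⟨⟨P w, hP w⟩⟩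
  refine le_trans (le_ciInf fun y => ?_) (ha.1 w hw hwm)
  have h1 : w - y.1 = (w - P w) + (P w - y.1) := by abel
  have h2 := hPo w (P w - y.1) ((discDivFreeSubmodule Xh Qh).sub_mem (hP w) y.2)
  have h3 := norm_le_norm_map_add_of_orthogonal (scaledEmbedding Ω h) h2
  rw [← h1] at h3
  exact h3.trans (le_add_of_sq_eq_add (norm_nonneg _) (mul_nonneg hh.le (norm_nonneg _))
    (norm_scaledEmbedding_sq h _))

variable (S : ErrorSetting Ω T ν ω χ α h H C C₁ C₂ C₃ m Xh Qh IH R f u u_t v v_t p lam)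
include S

set_option maxHeartbeats 4000000 in
/-- The scaled `H¹` projection. Its orthogonality turns `(η_t, y)` into `-h² (∇η_t, ∇y)`, which is
the source of the order `h^{m+2}`. -/
lemma ErrorSetting.exists_scaled_projection :
    ∃ P : H01 Ω →L[ℝ] H01 Ω, IsGoodProjection Xh Qh m h C T u u_t P ∧
      ∀ᵐ s ∂volume.restrict (Ioc 0 T),
        ‖fn (u_t s - P (u_t s))‖ ≤ C * h ^ (m + 1) * semiVec (m + 1) (fn (u_t s)) := by
  have := S.finite
  have hh := S.h_pos
  obtain ⟨P, hP, hPo⟩ := exists_projection (scaledEmbedding Ω h) (discDivFreeSubmodule Xh Qh)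
  have hb : ∀ {w : H01 Ω}, w ∈ divFree Ω → MemHVec (m + 1) (fn w) →
      ‖fn (w - P w)‖ ≤ C * h ^ (m + 1) * semiVec (m + 1) (fn w) ∧
      ‖grad (w - P w)‖ ≤ C * h ^ m * semiVec (m + 1) (fn w) := by
    intro w hw hwm
    have h1 := norm_scaledEmbedding_sub_le hh S.approx hP hPo hw hwm
    obtain ⟨h3, h4⟩ := le_and_le_of_sq_eq_add (norm_nonneg _) (norm_scaledEmbedding_sq h (w - P w))
    refine ⟨h3.trans h1, le_of_mul_le_mul_left ((h4.trans h1).trans_eq ?_) hh⟩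
    ring
  refine ⟨P, ⟨hP, fun s hs => (hb (S.exact_sol.div_u s hs) (S.regular.mem_u s hs)).1,
    fun s hs => (hb (S.exact_sol.div_u s hs) (S.regular.mem_u s hs)).2, ?_⟩, ?_⟩
  · filter_upwards [S.regular.mem_u_t] with s hs y hy
    have h1 := hPo (u_t s) y hy
    rw [inner_scaledEmbedding] at h1
    have h2 : inner ℝ (fn (u_t s - P (u_t s))) (fn y)
        = -(h ^ 2 * inner ℝ (grad (u_t s - P (u_t s))) (grad y)) := by linarith
    rw [h2, abs_neg, abs_mul, abs_of_pos (by positivity)]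
    calc h ^ 2 * |inner ℝ (grad (u_t s - P (u_t s))) (grad y)|
        ≤ h ^ 2 * (C * h ^ m * semiVec (m + 1) (fn (u_t s)) * ‖grad y‖) := by
          gcongr
          exact (abs_real_inner_le_norm _ _).trans (by gcongr; exact (hb hs.1 hs.2).2)
      _ = _ := by ring
  · filter_upwards [S.regular.mem_u_t] with s hs
    exact (hb hs.1 hs.2).1

/-- The `L²` projection, if it has the approximation property. -/
lemma ErrorSetting.exists_L2_projection (hp : ProjectionApproximates Xh Qh m h C T u) :
    ∃ P : H01 Ω →L[ℝ] H01 Ω, IsGoodProjection Xh Qh m h C T u u_t P ∧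
      ∀ w, ∀ y ∈ discDivFree Xh Qh, inner ℝ (fn (w - P w)) (fn y) = 0 := by
  have := S.finite
  have hh := S.h_pos
  have hC := S.C_pos
  obtain ⟨P, hP, hPo⟩ := exists_projection (fnCLM Ω) (discDivFreeSubmodule Xh Qh)
  refine ⟨P, ⟨hP, fun s hs => ?_, fun s hs => ?_, ?_⟩, hPo⟩
  · have h1 := hp s hs (P (u s)) (hP _) (hPo _)
    have h2 : 0 ≤ h * ‖grad (u s - P (u s))‖ := by positivity
    linarith
  · have h1 := hp s hs (P (u s)) (hP _) (hPo _)
    have h2 : 0 ≤ ‖fn (u s - P (u s))‖ := norm_nonneg _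
    refine le_of_mul_le_mul_left (a := h) ?_ hh
    have e : h * (C * h ^ m * semiVec (m + 1) (fn (u s)))
      = C * h ^ (m + 1) * semiVec (m + 1) (fn (u s)) := by ring
    rw [e]
    linarith
  · refine Filter.Eventually.of_forall fun s y hy => ?_
    have h1 : inner ℝ (fn (u_t s - P (u_t s))) (fn y) = 0 := hPo (u_t s) y hy
    have := semiVec_nonneg (m + 1) (fn (u_t s))
    rw [h1, abs_zero]
    positivity

set_option maxHeartbeats 4000000 in
/-- The projection error at time `0` is controlled by that at time `t` and its time derivative. This
avoids the supremum of `|u|_{m+1}`, whose coefficient in the estimate has the factor `C₃`, which may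
be small if `I_H = 0`. -/
lemma ErrorSetting.initial_projection_error_le {P : H01 Ω →L[ℝ] H01 Ω}
    (hP : IsGoodProjection Xh Qh m h C T u u_t P)
    (hPt : ∀ᵐ s ∂volume.restrict (Ioc 0 T),
      ‖fn (u_t s - P (u_t s))‖ ≤ C * h ^ (m + 1) * semiVec (m + 1) (fn (u_t s)))
    {t : ℝ} (ht : t ∈ Icc 0 T) :
    ‖fn (u 0 - P (u 0))‖ ^ 2 ≤ ‖fn (u t - P (u t))‖ ^ 2
      + ν * (C ^ 2 * h ^ (2 * m)) * (∫ s in (0 : ℝ)..T, semiVec (m + 1) (fn (u s)) ^ 2)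
      + C ^ 2 * h ^ (2 * m + 4) / ν
        * (∫ s in (0 : ℝ)..t, semiVec (m + 1) (fn (u_t s)) ^ 2) := by
  have hT := S.T_pos.le
  have hν := S.ν_pos
  have hh := S.h_pos
  have hC := S.C_pos
  have hη : HasTimeDeriv T (fun s => fnCLM Ω (u s - P (u s)))
      (fun s => fnCLM Ω (u_t s - P (u_t s))) :=
    (S.exact_sol.timeDeriv.sub (S.exact_sol.timeDeriv.clm_comp hT P) hT).clm_comp hT (fnCLM Ω)
  refine hη.norm_sq_zero_le ht (by positivity) (fun s => sq_nonneg _)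
    S.intervalIntegrable_semiVec_sq
    ((intervalIntegrable_iff_integrableOn_Ioc_of_le hT).2 S.regular.int_u_t) ?_
  filter_upwards [hPt, ae_restrict_mem measurableSet_Ioc] with s hs hst
  have hsT : s ∈ Icc 0 T := ⟨hst.1.le, hst.2⟩
  have h1 := (abs_le.1 (abs_real_inner_le_norm (fn (u s - P (u s)))
    (fn (u_t s - P (u_t s))))).1
  have h2 := mul_le_mul (hP.approx_fn s hsT) hs (norm_nonneg _)
    ((norm_nonneg _).trans (hP.approx_fn s hsT))
  have h3 := two_mul_le_young hν (C * h ^ m * semiVec (m + 1) (fn (u s)))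
    (C * h ^ (m + 2) * semiVec (m + 1) (fn (u_t s)))
  have e1 : C * h ^ (m + 1) * semiVec (m + 1) (fn (u s))
      * (C * h ^ (m + 1) * semiVec (m + 1) (fn (u_t s)))
    = C * h ^ m * semiVec (m + 1) (fn (u s))
      * (C * h ^ (m + 2) * semiVec (m + 1) (fn (u_t s))) := by ring
  have e2 : ν * (C * h ^ m * semiVec (m + 1) (fn (u s))) ^ 2
    = ν * (C ^ 2 * h ^ (2 * m)) * semiVec (m + 1) (fn (u s)) ^ 2 := by ring
  have e3 : (C * h ^ (m + 2) * semiVec (m + 1) (fn (u_t s))) ^ 2 / ν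
    = C ^ 2 * h ^ (2 * m + 4) / ν * semiVec (m + 1) (fn (u_t s)) ^ 2 := by ring
  simp only [fnCLM_apply]
  linarith

end Projections

/-! ### The error estimate -/

lemma norm_add_sq_le_young {E : Type*} [NormedAddCommGroup E] {ε : ℝ} (hε : 0 < ε) (x y : E) :
    ‖x + y‖ ^ 2 ≤ (1 + ε) * ‖x‖ ^ 2 + (1 + 1 / ε) * ‖y‖ ^ 2 := by
  have h1 := pow_le_pow_left₀ (norm_nonneg _) (norm_add_le x y) 2
  have h2 := two_mul_le_young hε ‖x‖ ‖y‖
  have e : ‖y‖ ^ 2 / ε = 1 / ε * ‖y‖ ^ 2 := by ring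
  linarith

/-- The arithmetic of the constants: splitting the error at times `t` and `0` with weight `δ / 3`
costs the factor `(1 + δ / 3)² ≤ 1 + δ` for the initial error, and a factor of at most `4 / 3` for
the terms without a free constant. -/
lemma combine_with_weight {δ E F D Φ₀ e₀ η₀ η₁ e₁ diss W W' Z₁ Z₂ Z₃ Z₄ Z₅ Z₆ : ℝ}
    (hδ : 0 < δ) (hδ1 : δ ≤ 1) (hE : 0 ≤ E) (hE1 : E ≤ 1) (hD : 0 ≤ D)
    (he₀ : 0 ≤ e₀) (hη₀ : 0 ≤ η₀) (hW0 : 0 ≤ W)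
    (hZ₁ : 0 ≤ Z₁) (hZ₂ : 0 ≤ Z₂) (hZ₃ : 0 ≤ Z₃) (hZ₄ : 0 ≤ Z₄) (hZ₅ : 0 ≤ Z₅) (hZ₆ : 0 ≤ Z₆)
    (h1 : F + D ≤ E * Φ₀ + (3 * Z₁ + W + 70 * Z₂ + 210 * Z₃ + 70 * Z₄ + 70 * Z₆))
    (hW : 4 / 3 * W ≤ W') (h2 : diss ≤ D + 4 * Z₆)
    (h3 : e₁ ≤ (1 + δ / 3) * F + (1 + 1 / (δ / 3)) * η₁)
    (h4 : Φ₀ ≤ (1 + δ / 3) * e₀ + (1 + 1 / (δ / 3)) * η₀)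
    (h5 : η₁ ≤ Z₅) (h6 : η₀ ≤ Z₅ + Z₆ + Z₄) :
    e₁ + diss ≤ (1 + δ) * E * e₀ + 40 / δ * Z₁ + W' + 7 * (40 / δ) * Z₂ + 7 * (40 / δ) * Z₃
      + 7 * (40 / δ) * Z₄ + 40 / δ * Z₅ + 8 * (40 / δ) * Z₆ := by
  obtain ⟨r, hr⟩ : ∃ r, r = 1 / δ := ⟨_, rfl⟩
  have hr1 : 1 ≤ r := by rw [hr, le_div_iff₀ hδ]; linarith
  have hδr : δ * r = 1 := by rw [hr]; field_simp
  have e1 : 1 / (δ / 3) = 3 * r := by rw [hr]; field_simp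
  have e2 : 40 / δ = 40 * r := by rw [hr]; ring
  rw [e1] at h3 h4
  rw [e2]
  have a1 := mul_le_mul_of_nonneg_left h1 (by positivity : 0 ≤ 1 + δ / 3)
  have a2 := mul_le_mul_of_nonneg_left h4 (by positivity : 0 ≤ (1 + δ / 3) * E)
  have a3 : (1 + δ / 3) * (1 + δ / 3) * (E * e₀) ≤ (1 + δ) * (E * e₀) := by
    refine mul_le_mul_of_nonneg_right ?_ (by positivity)
    nlinarith
  have a4 : (1 + δ / 3) * E * ((1 + 3 * r) * η₀) ≤ 6 * r * (Z₅ + Z₆ + Z₄) := by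
    have b1 : (1 + δ / 3) * (1 + 3 * r) ≤ 6 * r := by
      have : (1 + δ / 3) * (1 + 3 * r) = 1 + 3 * r + δ / 3 + δ * r := by ring
      rw [this, hδr]; linarith
    calc (1 + δ / 3) * E * ((1 + 3 * r) * η₀) = E * (((1 + δ / 3) * (1 + 3 * r)) * η₀) := by ring
      _ ≤ 1 * (((1 + δ / 3) * (1 + 3 * r)) * η₀) := by
          apply mul_le_mul_of_nonneg_right hE1
          positivity
      _ ≤ 6 * r * (Z₅ + Z₆ + Z₄) := by
          rw [one_mul]
          exact mul_le_mul b1 h6 hη₀ (by positivity)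
  have a5 : (1 + 3 * r) * η₁ ≤ 4 * r * Z₅ := by
    calc (1 + 3 * r) * η₁ ≤ (1 + 3 * r) * Z₅ := by gcongr
      _ ≤ 4 * r * Z₅ := by gcongr; linarith
  have a6 : 0 ≤ δ * D := by positivity
  have a7 : ∀ {Z : ℝ}, 0 ≤ Z → (1 + δ / 3) * Z ≤ 4 / 3 * Z := fun hZ => by gcongr; linarith
  have a8 : ∀ {Z : ℝ}, 0 ≤ Z → Z ≤ r * Z := fun hZ => le_mul_of_one_le_left hZ hr1
  have c1 := a7 hZ₁
  have c2 := a7 hZ₂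
  have c3 := a7 hZ₃
  have c4 := a7 hZ₄
  have c6 := a7 hZ₆
  have cW := a7 hW0
  have d1 := a8 hZ₁
  have d2 := a8 hZ₂
  have d3 := a8 hZ₃
  have d4 := a8 hZ₄
  have d5 := a8 hZ₅
  have d6 := a8 hZ₆
  linarith

section Setting

variable {d : ℕ} {Ω : Set (Vec d)} {T ν ω χ α h H C C₁ C₂ C₃ : ℝ} {m : ℕ}
  {Xh : Submodule ℝ (H01 Ω)} {Qh : Submodule ℝ (L2 Ω ℝ)}
  {IH : L2 Ω (Vec d) →L[ℝ] L2 Ω (Vec d)} {R : L2 Ω (Vec d) → L2 Ω (Vec d)}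
  {f : ℝ → (H01 Ω →L[ℝ] ℝ)} {u u_t v v_t : ℝ → H01 Ω} {p lam : ℝ → L2 Ω ℝ}

/-- The terms of the error bound, apart from the initial error and the model error, with generic
constant `C²`. -/
noncomputable def boundTerm {d : ℕ} {Ω : Set (Vec d)} (m : ℕ) (h T ν α C C₃ : ℝ)
    (u u_t v : ℝ → H01 Ω) (p : ℝ → L2 Ω ℝ) (t : ℝ) : Fin 6 → ℝ :=
  ![C₃ * C ^ 2 * (2 / α) * h ^ (2 * m + 2)
      * (⨆ s : Icc (0 : ℝ) T, semiVec (m + 1) (fn (u s)) ^ 2),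
    1 / ν * Mconst Ω ^ 2
      * (bochnerNorm 4 T (fun s => grad (v s)) ^ 2 + bochnerNorm 4 T (fun s => grad (u s)) ^ 2)
      * (C ^ 2 * h ^ (2 * m) * √(∫ s in (0 : ℝ)..T, semiVec (m + 1) (fn (u s)) ^ 4)),
    1 / ν * C ^ 2 * h ^ (2 * m) * (∫ s in (0 : ℝ)..T, semi m (p s) ^ 2),
    C ^ 2 * h ^ (2 * m + 4) / ν * (∫ s in (0 : ℝ)..t, semiVec (m + 1) (fn (u_t s)) ^ 2),
    C ^ 2 * h ^ (2 * m + 2) * semiVec (m + 1) (fn (u t)) ^ 2,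
    ν * (C ^ 2 * h ^ (2 * m)) * (∫ s in (0 : ℝ)..T, semiVec (m + 1) (fn (u s)) ^ 2)]

lemma errorBound_eq (κ k t : ℝ) :
    errorBound m h H T ν ω χ α C₁ C₃ u u_t v p κ (k * C ^ 2) t
      = κ * Real.exp (-(α / 2 * χ) * t) * ‖fn (u 0 - v 0)‖ ^ 2
        + k * boundTerm m h T ν α C C₃ u u_t v p t 0
        + 2 * ω ^ 2 * (1 / χ + 7 * C₁ ^ 2 / (2 * ν) * H ^ 2)
          * bochnerNorm 2 T (fun s => fn (u s)) ^ 2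
        + 7 * k * boundTerm m h T ν α C C₃ u u_t v p t 1
        + 7 * k * boundTerm m h T ν α C C₃ u u_t v p t 2
        + 7 * k * boundTerm m h T ν α C C₃ u u_t v p t 3
        + k * boundTerm m h T ν α C C₃ u u_t v p t 4
        + 8 * k * boundTerm m h T ν α C C₃ u u_t v p t 5 := by
  simp only [errorBound, boundTerm, Matrix.cons_val, neg_mul]
  ring

lemma errorEnergy_eq (t : ℝ) :
    errorEnergy ν χ α u v t = ‖fn (u t - v t)‖ ^ 2 + ν / 2 * ∫ s in (0 : ℝ)..t,
      Real.exp (-(α / 2 * χ) * (t - s)) * ‖grad (u s - v s)‖ ^ 2 := by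
  simp only [errorEnergy, neg_mul]

lemma IsGoodProjection.norm_sq_le_boundTerm {P : H01 Ω →L[ℝ] H01 Ω}
    (hP : IsGoodProjection Xh Qh m h C T u u_t P) {t : ℝ} (ht : t ∈ Icc 0 T) :
    ‖fn (u t - P (u t))‖ ^ 2 ≤ boundTerm m h T ν α C C₃ u u_t v p t 4 := by
  refine (pow_le_pow_left₀ (norm_nonneg _) (hP.approx_fn t ht) 2).trans_eq ?_
  simp only [boundTerm, Matrix.cons_val]
  ring

variable (S : ErrorSetting Ω T ν ω χ α h H C C₁ C₂ C₃ m Xh Qh IH R f u u_t v v_t p lam)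
include S

lemma ErrorSetting.boundTerm_nonneg {t : ℝ} (ht : t ∈ Icc 0 T) (i : Fin 6) :
    0 ≤ boundTerm m h T ν α C C₃ u u_t v p t i := by
  have hh := S.h_pos
  have hν := S.ν_pos
  have hα := S.α_pos
  have hC₃ := S.C₃_pos
  have h0 : 0 ≤ ⨆ s : Icc (0 : ℝ) T, semiVec (m + 1) (fn (u s)) ^ 2 :=
    Real.iSup_nonneg fun s => sq_nonneg _
  have h1 : 0 ≤ ∫ s in (0 : ℝ)..T, semi m (p s) ^ 2 :=
    intervalIntegral.integral_nonneg S.T_pos.le fun s _ => sq_nonneg _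
  have h2 : 0 ≤ ∫ s in (0 : ℝ)..t, semiVec (m + 1) (fn (u_t s)) ^ 2 :=
    intervalIntegral.integral_nonneg ht.1 fun s _ => sq_nonneg _
  have h3 : 0 ≤ ∫ s in (0 : ℝ)..T, semiVec (m + 1) (fn (u s)) ^ 2 :=
    intervalIntegral.integral_nonneg S.T_pos.le fun s _ => sq_nonneg _
  fin_cases i <;> simp only [boundTerm, Fin.zero_eta, Fin.mk_one, Fin.reduceFinMk,
    Matrix.cons_val] <;> positivity

lemma ErrorSetting.discrete_error_le_boundTerm {P : H01 Ω →L[ℝ] H01 Ω}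
    (hP : IsGoodProjection Xh Qh m h C T u u_t P) {t : ℝ} (ht : t ∈ Icc 0 T) :
    ‖fn (P (u t) - v t)‖ ^ 2 + ∫ s in (0 : ℝ)..t,
        Real.exp (-(α / 2 * χ) * (t - s)) * (4 / 7 * ν * ‖grad (P (u s) - v s)‖ ^ 2)
      ≤ Real.exp (-(α / 2 * χ) * t) * ‖fn (P (u 0) - v 0)‖ ^ 2
        + (3 * boundTerm m h T ν α C C₃ u u_t v p t 0
        + ω ^ 2 * (3 / 2 * (1 / χ) + 14 / 3 * (C₁ ^ 2 * H ^ 2 / ν))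
            * bochnerNorm 2 T (fun s => fn (u s)) ^ 2
        + 70 * boundTerm m h T ν α C C₃ u u_t v p t 1
        + 210 * boundTerm m h T ν α C C₃ u u_t v p t 2
        + 70 * boundTerm m h T ν α C C₃ u u_t v p t 3
        + 70 * boundTerm m h T ν α C C₃ u u_t v p t 5) := by
  refine (S.discrete_error_le_bochnerNorm hP ht).trans_eq ?_
  simp only [boundTerm, Matrix.cons_val]
  ring

lemma ErrorSetting.dissipation_le_boundTerm {P : H01 Ω →L[ℝ] H01 Ω}
    (hP : IsGoodProjection Xh Qh m h C T u u_t P) {t : ℝ} (ht : t ∈ Icc 0 T) :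
    ν / 2 * ∫ s in (0 : ℝ)..t, Real.exp (-(α / 2 * χ) * (t - s)) * ‖grad (u s - v s)‖ ^ 2
      ≤ (∫ s in (0 : ℝ)..t,
        Real.exp (-(α / 2 * χ) * (t - s)) * (4 / 7 * ν * ‖grad (P (u s) - v s)‖ ^ 2))
        + 4 * boundTerm m h T ν α C C₃ u u_t v p t 5 := by
  refine (S.dissipation_le hP ht).trans_eq ?_
  simp only [boundTerm, Matrix.cons_val]
  ring

/-- There is room by a factor `4 / 3` in the constant of the model error. -/
lemma ErrorSetting.model_error_le :
    4 / 3 * (ω ^ 2 * (3 / 2 * (1 / χ) + 14 / 3 * (C₁ ^ 2 * H ^ 2 / ν))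
        * bochnerNorm 2 T (fun s => fn (u s)) ^ 2)
      ≤ 2 * ω ^ 2 * (1 / χ + 7 * C₁ ^ 2 / (2 * ν) * H ^ 2)
        * bochnerNorm 2 T (fun s => fn (u s)) ^ 2 := by
  have hν := S.ν_pos
  have h1 : 0 ≤ ω ^ 2 * (C₁ ^ 2 * H ^ 2 / ν) * bochnerNorm 2 T (fun s => fn (u s)) ^ 2 := by
    positivity
  have e : 7 * C₁ ^ 2 / (2 * ν) * H ^ 2 = 7 / 2 * (C₁ ^ 2 * H ^ 2 / ν) := by ring
  rw [e]
  linarith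

lemma ErrorSetting.model_error_nonneg :
    0 ≤ ω ^ 2 * (3 / 2 * (1 / χ) + 14 / 3 * (C₁ ^ 2 * H ^ 2 / ν))
        * bochnerNorm 2 T (fun s => fn (u s)) ^ 2 := by
  have hν := S.ν_pos
  have hχ := S.χ_pos
  positivity

set_option maxHeartbeats 4000000 in
/-- The estimate from the scaled `H¹` projection. -/
lemma ErrorSetting.errorEnergy_le {δ : ℝ} (hδ : 0 < δ) (hδ1 : δ ≤ 1) {t : ℝ}
    (ht : t ∈ Icc 0 T) :
    errorEnergy ν χ α u v t
      ≤ errorBound m h H T ν ω χ α C₁ C₃ u u_t v p (1 + δ) (40 / δ * C ^ 2) t := by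
  obtain ⟨P, hP, hPt⟩ := S.exists_scaled_projection
  have hν := S.ν_pos
  have hχ := S.χ_pos
  have hα := S.α_pos
  have hsplit : ∀ s, fn (u s - v s) = fn (P (u s) - v s) + fn (u s - P (u s)) := fun s => by
    rw [← fn_add]; congr 1; abel
  have hsplit0 : fn (P (u 0) - v 0) = fn (u 0 - v 0) + -fn (u 0 - P (u 0)) := by
    rw [hsplit]; abel
  have h0 := norm_add_sq_le_young (ε := δ / 3) (by positivity) (fn (u 0 - v 0))
    (-fn (u 0 - P (u 0)))
  rw [← hsplit0, norm_neg] at h0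
  have h1 := norm_add_sq_le_young (ε := δ / 3) (by positivity) (fn (P (u t) - v t))
    (fn (u t - P (u t)))
  rw [← hsplit] at h1
  have h5 : _ ≤ boundTerm m h T ν α C C₃ u u_t v p t 4 := hP.norm_sq_le_boundTerm ht
  have hD : 0 ≤ ∫ s in (0 : ℝ)..t,
      Real.exp (-(α / 2 * χ) * (t - s)) * (4 / 7 * ν * ‖grad (P (u s) - v s)‖ ^ 2) :=
    intervalIntegral.integral_nonneg ht.1 fun s _ => by positivity
  have hE1 : Real.exp (-(α / 2 * χ) * t) ≤ 1 := by
    rw [Real.exp_le_one_iff]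
    have : 0 ≤ α / 2 * χ * t := mul_nonneg (by positivity) ht.1
    linarith
  refine (errorEnergy_eq t).trans_le (LE.le.trans_eq ?_ (errorBound_eq _ _ t).symm)
  exact combine_with_weight hδ hδ1 (Real.exp_pos _).le hE1 hD (sq_nonneg _) (sq_nonneg _)
    S.model_error_nonneg (S.boundTerm_nonneg ht 0) (S.boundTerm_nonneg ht 1)
    (S.boundTerm_nonneg ht 2) (S.boundTerm_nonneg ht 3) (S.boundTerm_nonneg ht 4)
    (S.boundTerm_nonneg ht 5) (S.discrete_error_le_boundTerm hP ht) S.model_error_le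
    (S.dissipation_le_boundTerm hP ht) h1 h0 h5
    ((S.initial_projection_error_le hP hPt ht).trans
      (add_le_add_left (add_le_add_left h5 _) _))

set_option maxHeartbeats 4000000 in
/-- The estimate from the `L²` projection: the error splits orthogonally, and the initial error is
not increased. -/
lemma ErrorSetting.errorEnergy_le_of_projectionApproximates
    (hp : ProjectionApproximates Xh Qh m h C T u) {t : ℝ} (ht : t ∈ Icc 0 T) :
    errorEnergy ν χ α u v t
      ≤ errorBound m h H T ν ω χ α C₁ C₃ u u_t v p 1 (40 * C ^ 2) t := by
  obtain ⟨P, hP, hPo⟩ := S.exists_L2_projection hp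
  have hsplit : ∀ s ∈ Icc 0 T, ‖fn (u s - v s)‖ ^ 2
      = ‖fn (u s - P (u s))‖ ^ 2 + ‖fn (P (u s) - v s)‖ ^ 2 := fun s hs => by
    have e : fn (u s - v s) = fn (u s - P (u s)) + fn (P (u s) - v s) := by
      rw [← fn_add]; congr 1; abel
    have hm : P (u s) - v s ∈ discDivFree Xh Qh :=
      (discDivFreeSubmodule Xh Qh).sub_mem (hP.mem _)
        ⟨S.nudged_sol.mem_v s hs, S.nudged_sol.div_v s hs⟩
    rw [e, norm_add_sq_real, hPo (u s) _ hm]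
    ring
  have h0 : ‖fn (P (u 0) - v 0)‖ ^ 2 ≤ ‖fn (u 0 - v 0)‖ ^ 2 := by
    rw [hsplit 0 (left_mem_Icc.2 S.T_pos.le)]
    exact le_add_of_nonneg_left (sq_nonneg _)
  have h0' := mul_le_mul_of_nonneg_left h0 (Real.exp_pos (-(α / 2 * χ) * t)).le
  have h1 := S.discrete_error_le_boundTerm hP ht
  have h2 := S.dissipation_le_boundTerm hP ht
  have h3 : _ ≤ boundTerm m h T ν α C C₃ u u_t v p t 4 := hP.norm_sq_le_boundTerm ht
  have h4 := S.model_error_le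
  have h5 := S.model_error_nonneg
  have b := S.boundTerm_nonneg ht
  have b0 := b 0
  have b1 := b 1
  have b2 := b 2
  have b3 := b 3
  have b4 := b 4
  have b5 := b 5
  have h6 := hsplit t ht
  refine (errorEnergy_eq t).trans_le (LE.le.trans_eq ?_ (errorBound_eq _ _ t).symm)
  linarith

end Setting

end NudgedNSE

theorem mainTheorem3 (C : ℝ) (hC : 0 < C) :
    ∃ c > 0, ∀ (d : ℕ) (Ω : Set (Vec d)) (T ν ω χ α h H C₁ C₂ C₃ : ℝ) (m : ℕ)
      (Xh : Submodule ℝ (H01 Ω)) (Qh : Submodule ℝ (L2 Ω ℝ))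
      (IH : L2 Ω (Vec d) →L[ℝ] L2 Ω (Vec d)) (R : L2 Ω (Vec d) → L2 Ω (Vec d))
      (f : ℝ → (H01 Ω →L[ℝ] ℝ)) (u u_t v v_t : ℝ → H01 Ω) (p lam : ℝ → L2 Ω ℝ),
      -- the domain and the parameters
      (d = 2 ∨ d = 3) → IsOpen Ω → Bornology.IsBounded Ω →
      0 < T → 0 < ν → 0 < χ → 0 < α → α < 1 → 0 < h → 0 < H → 0 < C₁ → 0 < C₃ →
      IsTrilinearConstant Ω C₂ →
      -- conforming finite element spaces with their approximation properties
      FiniteDimensional ℝ Xh → FiniteDimensional ℝ Qh → (∀ q ∈ Qh, q ∈ meanZero Ω) →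
      ApproxProperty Xh Qh m h C →
      -- the observation operator and the term omitted from the computational model
      IsObservation IH H C₁ C₃ → IsCoriolisLike R →
      -- the true solution and the semi-discrete nudged solution
      IsNSESolution Ω T ν ω R f u u_t p → HasSobolevRegularity m T u u_t p →
      IntegrableOn (fun t => ‖grad (u t)‖ ^ 4) (Set.Ioc 0 T) →
      IsNudgedSolution Xh Qh T ν χ IH f u v v_t lam →
      -- the conditions on `χ` and `H`
      α * χ ≤ χ - C₂ ^ 4 * (9261 / 8) * (ν ^ 3)⁻¹ * supNorm T (fun s => grad (v s)) ^ 4 →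
      0 < ν - C₁ ^ 2 * H ^ 2 * χ →
      -- the estimate, with the factor `1 + δ` in front of the initial error, and with the
      -- factor `1` if the `L²` projection of `u` onto `V^h` has the approximation property
      (∀ δ : ℝ, 0 < δ → δ ≤ 1 → ∀ t ∈ Set.Ioc 0 T,
        errorEnergy ν χ α u v t
          ≤ errorBound m h H T ν ω χ α C₁ C₃ u u_t v p (1 + δ) (c / δ) t) ∧
      (ProjectionApproximates Xh Qh m h C T u → ∀ t ∈ Set.Ioc 0 T,
        errorEnergy ν χ α u v t
          ≤ errorBound m h H T ν ω χ α C₁ C₃ u u_t v p 1 c t) := by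
  refine ⟨40 * C ^ 2, by positivity, ?_⟩
  intro d Ω T ν ω χ α h H C₁ C₂ C₃ m Xh Qh IH R f u u_t v v_t p lam hd _ hΩ hT hν hχ hα _ hh hH
    hC₁ hC₃ hC₂ hXh _ _ hap hI hR hu hreg _ hv hχ' hH'
  have S : ErrorSetting Ω T ν ω χ α h H C C₁ C₂ C₃ m Xh Qh IH R f u u_t v v_t p lam :=
    ⟨hd, hΩ, hT, hν, hχ, hα, hh, hH, hC, hC₁, hC₃, hC₂, hXh, hap, hI, hR, hu, hreg, hv, hχ', hH'⟩
  refine ⟨fun δ hδ hδ1 t ht => ?_, fun hp t ht =>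
    S.errorEnergy_le_of_projectionApproximates hp ⟨ht.1.le, ht.2⟩⟩
  have := S.errorEnergy_le hδ hδ1 ⟨ht.1.le, ht.2⟩
  rwa [div_mul_eq_mul_div] at this
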